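/- All graphs are finite. A \emph{Hoffman graph} $\mathfrak{H}$ is a graph whose vertices are labelled slim or fat, such that every fat vertex is adjacent to at least one slim vertex and the fat vertices are pairwise non-adjacent. For a vertex $x$ let $N^f(x)$ be the set of its fat neighbours; $\mathfrak{H}$ is \emph{fat} if $N^f(x)\neq\emptyset$ for every slim $x$. If the adjacency matrix of $\mathfrak{H}$ is $\begin{pmatrix}A_s & C\\ C^T & 0\end{pmatrix}$ (slim vertices first), then $\lambda_{\min}(\mathfrak{H})$ denotes the smallest eigenvalue of $B(\mathfrak{H})=A_s-CC^T$. A \emph{Hoffman subgraph} is an induced labelled subgraph which is itself a Hoffman graph. A \emph{decomposition} of $\mathfrak{H}$ is a family of nonempty Hoffman subgraphs $\mathfrak{H}^1,\dots,\mathfrak{H}^n$ whose vertex sets cover $V(\mathfrak{H})$, such that the slim vertex sets of the $\mathfrak{H}^i$ are pairwise disjoint, every fat neighbour of a slim vertex of $\mathfrak{H}^i$ lies in $\mathfrak{H}^i$, and for slim $x\in\mathfrak{H}^i$, $y\in\mathfrak{H}^j$ with $i\ne j$ one has $|N^f(x)\cap N^f(y)|\le 1$, with equality if and only if $x$ and $y$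 are adjacent. $\mathfrak{H}$ is \emph{indecomposable} if it has no decomposition with $n\ge 2$. An \emph{edge-signed graph} is a graph with each edge labelled $+$ or $-$; isomorphisms preserve the signs. The \emph{special graph} $\mathcal{S}(\mathfrak{H})$ is the edge-signed graph on the slim vertices of $\mathfrak{H}$ in which distinct $u,v$ are joined by a $(+)$-edge if they are adjacent in $\mathfrak{H}$ and $N^f(u)\cap N^f(v)=\emptyset$, and by a $(-)$-edge if they are non-adjacent in $\mathfrak{H}$ and $N^f(u)\cap N^f(v)\ne\emptyset$. For non-negative integers $p,q,r$ with $p+q\le r$, let $\mathcal{Q}_{p,q,r}$ be the edge-signed graph on the disjoint union $V_p\cup V_q\cup V_r$, $|V_i|=i$, in which any two vertices of $V_r$ are joined by a $(+)$-edge, $V_p$ is joined by a perfect matching of $(+)$-edges to a $p$-subset $U_p\subseteq V_r$, $V_q$ is joined by a perfect matching of $(-)$-edges to a $q$-subset $U_q\subseteq V_r\setminus U_p$, and there are no other edges. The $15$ exceptional edge-signed graphs are the following; $\mathcal{S}_{n,j}$ has vertex set $\{0,\dots,n-1\}$, and $ab$ denotes the edge $\{a,b\}$. \[ \begin{array}{lll}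 & E^+ & E^-\\ \mathcal{S}_{3,1} & \emptyset & 01,02\\ \mathcal{S}_{4,1} & \emptyset & 01,12,03\\ \mathcal{S}_{4,2} & 23 & 01,02\\ \mathcal{S}_{4,3} & 02,13 & 01\\ \mathcal{S}_{4,4} & 02,13,23 & 01\\ \mathcal{S}_{4,5} & 02,12,03,13,23 & \emptyset\\ \mathcal{S}_{5,1} & 01,02,13,24,34 & \emptyset\\ \mathcal{S}_{5,2} & 13,24,34 & 01,02\\ \mathcal{S}_{5,3} & 23,04,14 & 12,03\\ \mathcal{S}_{5,4} & 02,13,23,04,14,24,34 & \emptyset\\ \mathcal{S}_{5,5} & 01,23,04,14,24,34 & \emptyset\\ \mathcal{S}_{5,6} & 12,13,23,04,24,34 & 01\\ \mathcal{S}_{6,1} & 01,02,13,24,34,05,15,25,35,45 & \emptyset\\ \mathcal{S}_{6,2} & 03,13,04,24,34,15,25,35,45 & \emptyset\\ \mathcal{S}_{6,3} & 01,23,24,34,05,15,25,35,45 & \emptyset \end{array} \] \textbf{Theorem.} Let $\tau=\frac{1+\sqrt5}{2}$ and let $\mathfrak{H}$ be a fat indecomposable Hoffman graph with $\lambda_{\min}(\mathfrak{H})\ge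 -1-\tau$. (i) If some slim vertex of $\mathfrak{H}$ has at least two fat neighbours, then $\mathcal{S}(\mathfrak{H})$ is isomorphic to $\mathcal{Q}_{0,0,1}$, $\mathcal{Q}_{1,0,1}$ or $\mathcal{Q}_{0,1,1}$. (ii) If every slim vertex of $\mathfrak{H}$ has exactly one fat neighbour, then $\mathcal{S}(\mathfrak{H})$ is isomorphic to $\mathcal{Q}_{p,q,r}$ for some non-negative integers $p,q,r$ with $p+q\le r$, or to one of the $15$ exceptional edge-signed graphs above. -/

import Mathlib

noncomputable section

/-- The smallest eigenvalue of a real square matrix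
(see `isLeast_smallestEigenvalue` for symmetric matrices of positive size). -/
def smallestEigenvalue {ι : Type*} [Fintype ι] [DecidableEq ι] (M : Matrix ι ι ℝ) : ℝ :=
  sInf {x : ℝ | Module.End.HasEigenvalue (Matrix.toLin' M) x}

theorem isLeast_smallestEigenvalue {ι : Type*} [Fintype ι] [DecidableEq ι] [Nonempty ι]
    (M : Matrix ι ι ℝ) (hM : M.IsSymm) :
    IsLeast {x : ℝ | Module.End.HasEigenvalue (Matrix.toLin' M) x} (smallestEigenvalue M) := by
  have hH : M.IsHermitian := by
    rw [Matrix.IsHermitian, Matrix.conjTranspose_eq_transpose_of_trivial]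
    exact hM
  have hs : {x : ℝ | Module.End.HasEigenvalue (Matrix.toLin' M) x}
      = Set.range hH.eigenvalues := by
    rw [← hH.spectrum_real_eq_range_eigenvalues, ← Matrix.spectrum_toLin']
    ext x
    exact Module.End.hasEigenvalue_iff_mem_spectrum
  have hfin : (Set.range hH.eigenvalues).Finite := Set.finite_range _
  have hne : (Set.range hH.eigenvalues).Nonempty := Set.range_nonempty _
  unfold smallestEigenvalue
  rw [hs]
  exact ⟨hne.csInf_mem hfin, fun x hx => csInf_le hfin.bddBelow hx⟩

/-! ### Edge-signed graphs -/

/-- An edge-signed graph, given by its `(+)`-edges and its `(-)`-edges. -/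
structure EdgeSignedGraph (V : Type*) where
  pos : SimpleGraph V
  neg : SimpleGraph V
  disjoint : ∀ u v, pos.Adj u v → ¬ neg.Adj u v

namespace EdgeSignedGraph

/-- Isomorphism of edge-signed graphs. -/
def Isomorphic {V W : Type*} (S : EdgeSignedGraph V) (T : EdgeSignedGraph W) : Prop :=
  ∃ φ : V ≃ W, ∀ u v, (S.pos.Adj u v ↔ T.pos.Adj (φ u) (φ v)) ∧
    (S.neg.Adj u v ↔ T.neg.Adj (φ u) (φ v))

/-- The edge-signed graph `Q_{p,q,r}` (for `p + q ≤ r`): `V_r` is a clique of `(+)`-edges,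
`U_p` consists of the first `p` and `U_q` of the next `q` vertices of `V_r`, the set `V_p` is
perfectly matched to `U_p` by `(+)`-edges and `V_q` is perfectly matched to `U_q` by
`(-)`-edges. -/
def Q (p q r : ℕ) (h : p + q ≤ r) : EdgeSignedGraph (Fin p ⊕ Fin q ⊕ Fin r) where
  pos := SimpleGraph.fromRel fun a b =>
    match a, b with
    | .inl i, .inr (.inr k) => k = ⟨i.1, by omega⟩
    | .inr (.inr _), .inr (.inr _) => True
    | _, _ => False
  neg := SimpleGraph.fromRel fun a b =>
    match a, b with
    | .inr (.inl j), .inr (.inr k) => k = ⟨p + j.1, by omega⟩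
    | _, _ => False
  disjoint := by
    rintro (i | j | k) (i' | j' | k') <;> simp [SimpleGraph.fromRel_adj]

/-- The edge-signed graph on `{0, …, n-1}` with the given sets of `(+)`- and `(-)`-edges. -/
def ofEdges (n : ℕ) (P N : Finset (Sym2 (Fin n))) (h : Disjoint P N) :
    EdgeSignedGraph (Fin n) where
  pos := SimpleGraph.fromEdgeSet (P : Set (Sym2 (Fin n)))
  neg := SimpleGraph.fromEdgeSet (N : Set (Sym2 (Fin n)))
  disjoint := by
    intro u v hP hN
    simp only [SimpleGraph.fromEdgeSet_adj, Finset.mem_coe] at hP hN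
    exact Finset.disjoint_left.mp h hP.1 hN.1

/-! The 15 exceptional edge-signed graphs. -/

def S3_1 : EdgeSignedGraph (Fin 3) :=
  ofEdges 3 ∅ {s(0, 1), s(0, 2)} (by decide)

def S4_1 : EdgeSignedGraph (Fin 4) :=
  ofEdges 4 ∅ {s(0, 1), s(1, 2), s(0, 3)} (by decide)

def S4_2 : EdgeSignedGraph (Fin 4) :=
  ofEdges 4 {s(2, 3)} {s(0, 1), s(0, 2)} (by decide)

def S4_3 : EdgeSignedGraph (Fin 4) :=
  ofEdges 4 {s(0, 2), s(1, 3)} {s(0, 1)} (by decide)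

def S4_4 : EdgeSignedGraph (Fin 4) :=
  ofEdges 4 {s(0, 2), s(1, 3), s(2, 3)} {s(0, 1)} (by decide)

def S4_5 : EdgeSignedGraph (Fin 4) :=
  ofEdges 4 {s(0, 2), s(1, 2), s(0, 3), s(1, 3), s(2, 3)} ∅ (by decide)

def S5_1 : EdgeSignedGraph (Fin 5) :=
  ofEdges 5 {s(0, 1), s(0, 2), s(1, 3), s(2, 4), s(3, 4)} ∅ (by decide)

def S5_2 : EdgeSignedGraph (Fin 5) :=
  ofEdges 5 {s(1, 3), s(2, 4), s(3, 4)} {s(0, 1), s(0, 2)} (by decide)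

def S5_3 : EdgeSignedGraph (Fin 5) :=
  ofEdges 5 {s(2, 3), s(0, 4), s(1, 4)} {s(1, 2), s(0, 3)} (by decide)

def S5_4 : EdgeSignedGraph (Fin 5) :=
  ofEdges 5 {s(0, 2), s(1, 3), s(2, 3), s(0, 4), s(1, 4), s(2, 4), s(3, 4)} ∅ (by decide)

def S5_5 : EdgeSignedGraph (Fin 5) :=
  ofEdges 5 {s(0, 1), s(2, 3), s(0, 4), s(1, 4), s(2, 4), s(3, 4)} ∅ (by decide)

def S5_6 : EdgeSignedGraph (Fin 5) :=
  ofEdges 5 {s(1, 2), s(1, 3), s(2, 3), s(0, 4), s(2, 4), s(3, 4)} {s(0, 1)} (by decide)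

def S6_1 : EdgeSignedGraph (Fin 6) :=
  ofEdges 6 {s(0, 1), s(0, 2), s(1, 3), s(2, 4), s(3, 4),
    s(0, 5), s(1, 5), s(2, 5), s(3, 5), s(4, 5)} ∅ (by decide)

def S6_2 : EdgeSignedGraph (Fin 6) :=
  ofEdges 6 {s(0, 3), s(1, 3), s(0, 4), s(2, 4), s(3, 4),
    s(1, 5), s(2, 5), s(3, 5), s(4, 5)} ∅ (by decide)

def S6_3 : EdgeSignedGraph (Fin 6) :=
  ofEdges 6 {s(0, 1), s(2, 3), s(2, 4), s(3, 4),
    s(0, 5), s(1, 5), s(2, 5), s(3, 5), s(4, 5)} ∅ (by decide)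

/-- `S` is isomorphic to one of the 15 exceptional edge-signed graphs. -/
def IsExceptional {V : Type*} (S : EdgeSignedGraph V) : Prop :=
  S.Isomorphic S3_1 ∨
  S.Isomorphic S4_1 ∨ S.Isomorphic S4_2 ∨ S.Isomorphic S4_3 ∨
  S.Isomorphic S4_4 ∨ S.Isomorphic S4_5 ∨
  S.Isomorphic S5_1 ∨ S.Isomorphic S5_2 ∨ S.Isomorphic S5_3 ∨
  S.Isomorphic S5_4 ∨ S.Isomorphic S5_5 ∨ S.Isomorphic S5_6 ∨
  S.Isomorphic S6_1 ∨ S.Isomorphic S6_2 ∨ S.Isomorphic S6_3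

end EdgeSignedGraph

/-! ### Hoffman graphs -/

inductive VertexLabel
  | slim
  | fat

/-- A Hoffman graph on the vertex type `V`. -/
structure HoffmanGraph (V : Type*) where
  graph : SimpleGraph V
  label : V → VertexLabel
  exists_slim_adj : ∀ f, label f = .fat → ∃ v, label v = .slim ∧ graph.Adj f v
  fat_not_adj : ∀ f g, label f = .fat → label g = .fat → ¬ graph.Adj f g

namespace HoffmanGraph

variable {V : Type*} (H : HoffmanGraph V)

abbrev IsSlim (v : V) : Prop := H.label v = .slim

abbrev IsFatVertex (v : V) : Prop := H.label v = .fat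

/-- The type of slim vertices. -/
abbrev Slim : Type _ := {v : V // H.IsSlim v}

/-- The type of fat vertices. -/
abbrev Fat : Type _ := {v : V // H.IsFatVertex v}

/-- The set `N^f(x)` of fat neighbours of `x`. -/
def fatNeighbors (x : V) : Set V := {f | H.IsFatVertex f ∧ H.graph.Adj x f}

/-- A Hoffman graph is fat if every slim vertex has a fat neighbour. -/
def IsFat : Prop := ∀ v, H.IsSlim v → (H.fatNeighbors v).Nonempty

/-! #### Eigenvalues -/

open Classical in
/-- The block `A_s` of the adjacency matrix. -/
def slimBlock : Matrix H.Slim H.Slim ℝ :=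
  (H.graph.adjMatrix ℝ).submatrix Subtype.val Subtype.val

open Classical in
/-- The block `C` of the adjacency matrix. -/
def fatBlock : Matrix H.Slim H.Fat ℝ :=
  (H.graph.adjMatrix ℝ).submatrix Subtype.val Subtype.val

open Classical in
/-- The matrix `B(H) = A_s - C Cᵀ`. -/
def B [Fintype V] : Matrix H.Slim H.Slim ℝ :=
  H.slimBlock - H.fatBlock * H.fatBlock.transpose

theorem B_isSymm [Fintype V] : H.B.IsSymm := by
  classical
  have hs : H.slimBlock.transpose = H.slimBlock := by
    ext u v
    simp [slimBlock, SimpleGraph.adjMatrix_apply, SimpleGraph.adj_comm]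
  unfold Matrix.IsSymm B
  rw [Matrix.transpose_sub, Matrix.transpose_mul, Matrix.transpose_transpose, hs]

open Classical in
/-- The smallest eigenvalue of a Hoffman graph. -/
def lambdaMin [Fintype V] : ℝ := smallestEigenvalue H.B

/-! #### Decompositions -/

/-- An induced Hoffman subgraph of `H`: a set of vertices such that the induced labelled graph
is again a Hoffman graph. -/
structure Subgraph where
  verts : Set V
  exists_slim_adj : ∀ f ∈ verts, H.IsFatVertex f → ∃ v ∈ verts, H.IsSlim v ∧ H.graph.Adj f v

/-- A Hoffman subgraph as a Hoffman graph in its own right. -/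
def Subgraph.toHoffmanGraph {H : HoffmanGraph V} (K : H.Subgraph) : HoffmanGraph K.verts where
  graph := H.graph.induce K.verts
  label v := H.label v
  exists_slim_adj f hf := by
    obtain ⟨v, hv, hs, ha⟩ := K.exists_slim_adj f f.2 hf
    exact ⟨⟨v, hv⟩, hs, ha⟩
  fat_not_adj f g hf hg h := H.fat_not_adj f g hf hg h

/-- The family `K` of Hoffman subgraphs is a decomposition of `H`. -/
structure IsDecomposition {n : ℕ} (K : Fin n → H.Subgraph) : Prop where
  cover : ∀ v, ∃ i, v ∈ (K i).verts
  slim_disjoint : ∀ i j, i ≠ j → ∀ v, H.IsSlim v → v ∈ (K i).verts → v ∉ (K j).verts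
  fat_mem : ∀ i x y, H.IsSlim x → x ∈ (K i).verts → H.IsFatVertex y → H.graph.Adj x y →
    y ∈ (K i).verts
  common_fat_le : ∀ i j x y, i ≠ j → H.IsSlim x → x ∈ (K i).verts → H.IsSlim y →
    y ∈ (K j).verts → (H.fatNeighbors x ∩ H.fatNeighbors y).encard ≤ 1
  common_fat_eq_iff : ∀ i j x y, i ≠ j → H.IsSlim x → x ∈ (K i).verts → H.IsSlim y →
    y ∈ (K j).verts → ((H.fatNeighbors x ∩ H.fatNeighbors y).encard = 1 ↔ H.graph.Adj x y)

/-- `H` is decomposable if it has a decomposition into at least two (nonempty) parts. -/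
def Decomposable : Prop :=
  ∃ n : ℕ, 2 ≤ n ∧ ∃ K : Fin n → H.Subgraph,
    (∀ i, (K i).verts.Nonempty) ∧ H.IsDecomposition K

def Indecomposable : Prop := ¬ H.Decomposable

/-! #### The special graph -/

/-- The special graph of a Hoffman graph. -/
def specialGraph : EdgeSignedGraph H.Slim where
  pos :=
    { Adj := fun u v => u ≠ v ∧ H.graph.Adj u v ∧
        H.fatNeighbors u ∩ H.fatNeighbors v = ∅
      symm := ⟨fun u v h => ⟨h.1.symm, h.2.1.symm, by rw [Set.inter_comm]; exact h.2.2⟩⟩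
      loopless := ⟨fun _ h => h.1 rfl⟩ }
  neg :=
    { Adj := fun u v => u ≠ v ∧ ¬ H.graph.Adj u v ∧
        (H.fatNeighbors u ∩ H.fatNeighbors v).Nonempty
      symm := ⟨fun u v h => ⟨h.1.symm, fun h' => h.2.1 h'.symm,
        by rw [Set.inter_comm]; exact h.2.2⟩⟩
      loopless := ⟨fun _ h => h.1 rfl⟩ }
  disjoint := fun _ _ h h' => h'.2.1 h.2.1

end HoffmanGraph

end

noncomputable section

/-! ### Signed graphs with smallest eigenvalue at least `-φ` -/

open Real in
/-- The signed adjacency matrices `s` with smallest eigenvalue at least `-φ` (`φ` the golden ratio)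
for which some equivalence relation contains all pairs of sign `-1` and no pair of sign `1`. -/
structure GoldenSigning {V : Type*} (s : V → V → ℤ) : Prop where
  symm : ∀ u v, s u v = s v u
  diag : ∀ v, s v v = 0
  range : ∀ u v, s u v = 0 ∨ s u v = 1 ∨ s u v = -1
  classes : ∃ r : Setoid V, (∀ u v, s u v = 1 → ¬ r u v) ∧ ∀ u v, s u v = -1 → r u v
  nonneg : ∀ (n : ℕ) (f : Fin n → V), Function.Injective f → ∀ x : Fin n → ℝ,
    0 ≤ ∑ i, ∑ j, x i * x j * (s (f i) (f j) : ℝ) + goldenRatio * ∑ i, x i ^ 2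

theorem goldenRatio_gt : (1.61803 : ℝ) < Real.goldenRatio := by
  have h : (2.23606 : ℝ) < √5 := Real.lt_sqrt_of_sq_lt (by norm_num)
  unfold Real.goldenRatio; linarith

theorem goldenRatio_lt : Real.goldenRatio < (1.61804 : ℝ) := by
  have h : √5 < (2.23608 : ℝ) := (Real.sqrt_lt' (by norm_num)).2 (by norm_num)
  unfold Real.goldenRatio; linarith

namespace GoldenSigning

variable {V : Type*} {s : V → V → ℤ}

theorem nonneg_range (hs : GoldenSigning s) (n : ℕ) (g : ℕ → V)
    (hg : ∀ i < n, ∀ j < n, g i = g j → i = j) (x : ℕ → ℝ) :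
    0 ≤ ∑ i ∈ Finset.range n, ∑ j ∈ Finset.range n, x i * x j * (s (g i) (g j) : ℝ)
      + Real.goldenRatio * ∑ i ∈ Finset.range n, x i ^ 2 := by
  have h := hs.nonneg n (fun i => g i) (fun i j hij => Fin.ext (hg i i.2 j j.2 hij)) (fun i => x i)
  simpa only [Finset.sum_range] using h

/-- Cauchy-Schwarz for the form `s + φ`, applied to a vector and a coordinate vector. -/
theorem sq_sum_le (hs : GoldenSigning s) (n : ℕ) (g : ℕ → V)
    (hg : ∀ i < n, ∀ j < n, g i = g j → i = j) (v : V) (hv : ∀ i < n, g i ≠ v) (y : ℕ → ℝ) :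
    (∑ i ∈ Finset.range n, (s v (g i) : ℝ) * y i) ^ 2 ≤ Real.goldenRatio *
      (∑ i ∈ Finset.range n, ∑ j ∈ Finset.range n, y i * y j * (s (g i) (g j) : ℝ)
        + Real.goldenRatio * ∑ i ∈ Finset.range n, y i ^ 2) := by
  set A := ∑ i ∈ Finset.range n, (s v (g i) : ℝ) * y i with hA
  set C := ∑ i ∈ Finset.range n, ∑ j ∈ Finset.range n, y i * y j * (s (g i) (g j) : ℝ)
        + Real.goldenRatio * ∑ i ∈ Finset.range n, y i ^ 2 with hC
  have key : ∀ t : ℝ, 0 ≤ Real.goldenRatio * (t * t) + (2 * A) * t + C := by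
    intro t
    have h := hs.nonneg_range (n + 1) (fun | 0 => v | i + 1 => g i) (by
      rintro (_ | i) hi (_ | j) hj hij
      · rfl
      · exact absurd hij.symm (hv j (by omega))
      · exact absurd hij (hv i (by omega))
      · exact congrArg _ (hg i (by omega) j (by omega) hij)) (fun | 0 => t | i + 1 => y i)
    simp only [Finset.sum_range_succ', Finset.sum_add_distrib] at h
    have h1 : ∑ i ∈ Finset.range n, y i * t * (s (g i) v : ℝ) = t * A := by
      rw [hA, Finset.mul_sum]
      exact Finset.sum_congr rfl fun i _ => by rw [hs.symm]; ring
    have h2 : ∑ i ∈ Finset.range n, t * y i * (s v (g i) : ℝ) = t * A := by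
      rw [hA, Finset.mul_sum]
      exact Finset.sum_congr rfl fun i _ => by ring
    rw [h1, h2, hs.diag] at h
    rw [hC]
    push_cast at h
    linarith
  have := discrim_le_zero key
  unfold discrim at this
  linarith

theorem no_cycle (hs : GoldenSigning s) {a b c d e : V}
    (hab : a = b ∨ s a b = -1) (hbc : b = c ∨ s b c = -1) (hcd : c = d ∨ s c d = -1)
    (hde : d = e ∨ s d e = -1) : s a e ≠ 1 := by
  obtain ⟨r, hp, hn⟩ := hs.classes
  have step : ∀ {x y}, (x = y ∨ s x y = -1) → r x y := by
    rintro x y (rfl | h)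
    · exact r.refl _
    · exact hn _ _ h
  exact fun h => hp _ _ h
    (r.trans (r.trans (r.trans (step hab) (step hbc)) (step hcd)) (step hde))

end GoldenSigning

/-! ### A checker for one-vertex extensions -/

namespace SignTable

/-- The entry of a table, `0` outside of its range. -/
def entry (T : List (List ℤ)) (i j : ℕ) : ℤ := (T.getD i []).getD j 0

/-- Adjoin a new vertex, numbered `0`, with the given row of signs. -/
def extend (T : List (List ℤ)) (a : List ℤ) : List (List ℤ) :=
  (0 :: a) :: List.zipWith List.cons a T

/-- The dot product of two lists. -/
def dot : List ℤ → List ℤ → ℤ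
  | a :: l, b :: m => a * b + dot l m
  | _, _ => 0

/-- All lists of the given length with entries `0`, `1`, `-1`. -/
def signVectors : ℕ → List (List ℤ)
  | 0 => [[]]
  | n + 1 => (signVectors n).flatMap fun a => [0 :: a, 1 :: a, -1 :: a]

theorem dot_eq_sum : ∀ l m : List ℤ,
    dot l m = ∑ i ∈ Finset.range l.length, l.getD i 0 * m.getD i 0
  | [], m => by simp [dot]
  | a :: l, [] => by simp [dot]
  | a :: l, b :: m => by
    rw [dot, dot_eq_sum l m, List.length_cons, Finset.sum_range_succ']
    simp [add_comm]

theorem mem_signVectors : ∀ a : List ℤ, (∀ x ∈ a, x = 0 ∨ x = 1 ∨ x = -1) →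
    a ∈ signVectors a.length
  | [], _ => by simp [signVectors]
  | x :: a, h => by
    have ih := mem_signVectors a fun y hy => h y (List.mem_cons_of_mem _ hy)
    simp only [signVectors, List.length_cons, List.mem_flatMap]
    refine ⟨a, ih, ?_⟩
    rcases h x List.mem_cons_self with rfl | rfl | rfl <;> simp

theorem entry_extend_zero_succ (T : List (List ℤ)) (a : List ℤ) (j : ℕ) :
    entry (extend T a) 0 (j + 1) = a.getD j 0 := by
  simp [entry, extend]

theorem entry_extend_succ_zero (T : List (List ℤ)) (a : List ℤ) (i : ℕ)
    (h : a.length = T.length) (hi : i < T.length) :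
    entry (extend T a) (i + 1) 0 = a.getD i 0 := by
  simp [entry, extend, List.getD_eq_getElem?_getD, hi, h]

theorem entry_extend_succ_succ (T : List (List ℤ)) (a : List ℤ) (i j : ℕ)
    (h : a.length = T.length) (hi : i < T.length) :
    entry (extend T a) (i + 1) (j + 1) = entry T i j := by
  simp [entry, extend, List.getD_eq_getElem?_getD, hi, h]

/-- `g` numbers vertices so that their signs are those of the table. -/
structure IsEmbedding {V : Type*} (s : V → V → ℤ) (T : List (List ℤ)) (g : ℕ → V) : Prop where
  inj : ∀ i < T.length, ∀ j < T.length, g i = g j → i = j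
  sign : ∀ i < T.length, ∀ j < T.length, s (g i) (g j) = entry T i j

/-- Data showing that every extension of a signed graph by one vertex is impossible or known:
vectors with upper bounds on their product with the new row, closed walks with exactly one
positive edge, known tables together with a numbering, and whether a positive triangle is
permitted. -/
structure ExtensionCertificate where
  bounds : List (List ℤ × ℕ)
  cycles : List (List ℕ)
  targets : List (ℕ × List ℕ)
  triangle : Bool

/-- The form `s + φ` forces a new row to have product at most `b` with `y` in absolute value. -/
def checkBound (T : List (List ℤ)) (y : List ℤ) (b : ℕ) : Bool :=
  let d := dot y y
  let c := dot y (T.map fun r => dot r y) + d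
  let k := ((b : ℤ) + 1) ^ 2 - d
  y.length == T.length && decide (161803 * c < 100000 * k) && decide (161804 * c < 100000 * k)

/-- A closed walk with exactly one positive step, the others being negative or stationary. -/
def checkCycle (M : List (List ℤ)) : List ℕ → Bool
  | [a, b, c, d, e] =>
    decide (a < M.length) && decide (b < M.length) && decide (c < M.length) &&
    decide (d < M.length) && decide (e < M.length) &&
    (a == b || entry M a b == -1) && (b == c || entry M b c == -1) &&
    (c == d || entry M c d == -1) && (d == e || entry M d e == -1) && entry M a e == 1
  | _ => false

/-- The numbering `p` embeds the table `T` into `M`. -/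
def checkIso (M T : List (List ℤ)) (p : List ℕ) : Bool :=
  (List.range T.length).all fun i => decide (p.getD i 0 < M.length) &&
    (List.range T.length).all fun j =>
      (i == j || p.getD i 0 != p.getD j 0) && entry M (p.getD i 0) (p.getD j 0) == entry T i j

def checkTriangle (M : List (List ℤ)) : Bool :=
  (List.range M.length).any fun i => (List.range M.length).any fun j =>
    entry M i j == 1 && (List.range M.length).any fun k =>
      entry M j k == 1 && entry M i k == 1

def checkExtension (tables : List (List (List ℤ))) (T : List (List ℤ))
    (C : ExtensionCertificate) (a : List ℤ) : Bool :=
  a.all (· == 0) || C.bounds.any (fun y => decide (y.2 < (dot a y.1).natAbs)) ||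
    C.cycles.any (checkCycle (extend T a)) ||
    C.targets.any (fun t => checkIso (extend T a) (tables.getD t.1 []) t.2) ||
    (C.triangle && checkTriangle (extend T a))

def check (tables : List (List (List ℤ))) (T : List (List ℤ)) (C : ExtensionCertificate) : Bool :=
  T.all (fun r => r.length == T.length) && C.bounds.all (fun y => checkBound T y.1 y.2) &&
    (signVectors T.length).all (checkExtension tables T C)

theorem dot_le_of_checkBound {V : Type*} {s : V → V → ℤ} (hs : GoldenSigning s)
    {T : List (List ℤ)} (hT : ∀ r ∈ T, r.length = T.length) {g : ℕ → V} (hg : IsEmbedding s T g)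
    {v : V} (hv : ∀ i < T.length, g i ≠ v) {a : List ℤ} (ha : a.length = T.length)
    (hav : ∀ i < T.length, a.getD i 0 = s v (g i)) {y : List ℤ} {b : ℕ}
    (h : checkBound T y b = true) : (dot a y).natAbs ≤ b := by
  simp only [checkBound, Bool.and_eq_true, beq_iff_eq, decide_eq_true_eq] at h
  obtain ⟨⟨hy, h1⟩, h2⟩ := h
  set n := T.length with hn
  have key := hs.sq_sum_le n g hg.inj v hv fun i => (y.getD i 0 : ℝ)
  have e1 : ∑ i ∈ Finset.range n, (s v (g i) : ℝ) * (y.getD i 0 : ℝ) = (dot a y : ℝ) := by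
    rw [dot_eq_sum, ha]; push_cast
    exact Finset.sum_congr rfl fun i hi => by rw [hav i (Finset.mem_range.1 hi)]
  have e2 : ∑ i ∈ Finset.range n, (y.getD i 0 : ℝ) ^ 2 = (dot y y : ℝ) := by
    rw [dot_eq_sum, hy]; push_cast
    exact Finset.sum_congr rfl fun i _ => by ring
  have e3 : ∑ i ∈ Finset.range n, ∑ j ∈ Finset.range n,
      (y.getD i 0 : ℝ) * (y.getD j 0 : ℝ) * (s (g i) (g j) : ℝ)
        = (dot y (T.map fun r => dot r y) : ℝ) := by
    rw [dot_eq_sum, hy]; push_cast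
    refine Finset.sum_congr rfl fun i hi => ?_
    have hi' := Finset.mem_range.1 hi
    have : (T.map fun r => dot r y).getD i 0 = dot (T.getD i []) y := by
      simp [List.getD_eq_getElem?_getD, show i < T.length from hi']
    rw [this, dot_eq_sum, hT _ (by
      rw [List.getD_eq_getElem _ _ hi']; exact List.getElem_mem _)]
    push_cast
    rw [Finset.mul_sum]
    refine Finset.sum_congr rfl fun j hj => ?_
    rw [hg.sign i hi' j (Finset.mem_range.1 hj), entry]
    ring
  rw [e1, e2, e3] at key
  set d := dot y y
  set q := dot y (T.map fun r => dot r y)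
  by_contra! hlt
  have hsq : ((b : ℤ) + 1) ^ 2 ≤ dot a y ^ 2 := by
    rw [← Int.natAbs_sq (dot a y)]
    have : (b : ℤ) + 1 ≤ (dot a y).natAbs := by exact_mod_cast hlt
    gcongr
  have hsq' : ((b : ℝ) + 1) ^ 2 ≤ (dot a y : ℝ) ^ 2 := by exact_mod_cast hsq
  have h1' : 161803 * ((q : ℝ) + d) < 100000 * (((b : ℝ) + 1) ^ 2 - d) := by exact_mod_cast h1
  have h2' : 161804 * ((q : ℝ) + d) < 100000 * (((b : ℝ) + 1) ^ 2 - d) := by exact_mod_cast h2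
  have hφ := Real.goldenRatio_sq
  have g1 := goldenRatio_gt
  have g2 := goldenRatio_lt
  have key' : (dot a y : ℝ) ^ 2 ≤ Real.goldenRatio * (q + d) + d := by
    have : Real.goldenRatio * (q + Real.goldenRatio * d)
      = Real.goldenRatio * q + Real.goldenRatio ^ 2 * d := by ring
    rw [this, hφ] at key
    linarith
  rcases le_total 0 ((q : ℝ) + d) with h0 | h0
  · nlinarith
  · nlinarith

theorem isEmbedding_extend {V : Type*} {s : V → V → ℤ} (hs : GoldenSigning s)
    {T : List (List ℤ)} {g : ℕ → V} (hg : IsEmbedding s T g)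
    {v : V} (hv : ∀ i < T.length, g i ≠ v) {a : List ℤ} (ha : a.length = T.length)
    (hav : ∀ i < T.length, a.getD i 0 = s v (g i)) :
    IsEmbedding s (extend T a) (fun | 0 => v | i + 1 => g i) := by
  have hl : (extend T a).length = T.length + 1 := by simp [extend, ha]
  constructor
  · rw [hl]
    rintro (_ | i) hi (_ | j) hj hij
    · rfl
    · exact absurd hij.symm (hv j (by omega))
    · exact absurd hij (hv i (by omega))
    · exact congrArg _ (hg.inj i (by omega) j (by omega) hij)
  · rw [hl]
    rintro (_ | i) hi (_ | j) hj
    · simp [hs.diag, entry, extend]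
    · simp only [entry_extend_zero_succ, hav j (by omega)]
    · simp only [entry_extend_succ_zero T a i ha (by omega), hav i (by omega), hs.symm v]
    · simp only [entry_extend_succ_succ T a i j ha (by omega)]
      exact hg.sign i (by omega) j (by omega)

theorem IsEmbedding.of_checkIso {V : Type*} {s : V → V → ℤ} {M T : List (List ℤ)} {g : ℕ → V}
    (hg : IsEmbedding s M g) {p : List ℕ} (h : checkIso M T p = true) :
    IsEmbedding s T fun i => g (p.getD i 0) := by
  simp only [checkIso, List.all_eq_true, List.mem_range, Bool.and_eq_true, Bool.or_eq_true,
    decide_eq_true_eq, beq_iff_eq, bne_iff_ne] at h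
  constructor
  · intro i hi j hj hij
    by_contra hne
    exact ((h i hi).2 j hj).1.resolve_left hne
      (hg.inj _ (h i hi).1 _ (h j hj).1 hij)
  · intro i hi j hj
    rw [hg.sign _ (h i hi).1 _ (h j hj).1, ((h i hi).2 j hj).2]

theorem IsEmbedding.checkCycle_eq_false {V : Type*} {s : V → V → ℤ} (hs : GoldenSigning s)
    {M : List (List ℤ)} {g : ℕ → V} (hg : IsEmbedding s M g) (w : List ℕ) :
    checkCycle M w = false := by
  by_contra h
  rw [Bool.not_eq_false] at h
  unfold checkCycle at h
  split at h
  · rename_i a b c d e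
    simp only [Bool.and_eq_true, Bool.or_eq_true, decide_eq_true_eq, beq_iff_eq] at h
    obtain ⟨⟨⟨⟨⟨⟨⟨⟨⟨ha, hb⟩, hc⟩, hd⟩, he⟩, hab⟩, hbc⟩, hcd⟩, hde⟩, hae⟩ := h
    have step : ∀ {x y}, x < M.length → y < M.length → (x = y ∨ entry M x y = -1) →
        (g x = g y ∨ s (g x) (g y) = -1) := by
      rintro x y hx hy (rfl | h)
      · exact Or.inl rfl
      · exact Or.inr (by rw [hg.sign x hx y hy, h])
    exact hs.no_cycle (step ha hb hab) (step hb hc hbc) (step hc hd hcd) (step hd he hde)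
      (by rw [hg.sign a ha e he, hae])
  · simp at h

theorem IsEmbedding.exists_triangle {V : Type*} {s : V → V → ℤ}
    {M : List (List ℤ)} {g : ℕ → V} (hg : IsEmbedding s M g) (h : checkTriangle M = true) :
    ∃ a b c, s a b = 1 ∧ s b c = 1 ∧ s a c = 1 := by
  simp only [checkTriangle, List.any_eq_true, List.mem_range, Bool.and_eq_true, beq_iff_eq] at h
  obtain ⟨i, hi, j, hj, hij, k, hk, hjk, hik⟩ := h
  exact ⟨g i, g j, g k, by rw [hg.sign i hi j hj, hij], by rw [hg.sign j hj k hk, hjk],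
    by rw [hg.sign i hi k hk, hik]⟩

/-- A checked certificate describes all one-vertex extensions of the table. -/
theorem exists_target_of_check {V : Type*} {s : V → V → ℤ} (hs : GoldenSigning s)
    {tables : List (List (List ℤ))} {T : List (List ℤ)} {C : ExtensionCertificate}
    (hC : check tables T C = true) {g : ℕ → V} (hg : IsEmbedding s T g)
    {v : V} (hv : ∀ i < T.length, g i ≠ v) (hadj : ∃ i < T.length, s v (g i) ≠ 0) :
    (∃ t ∈ C.targets, ∃ g', IsEmbedding s (tables.getD t.1 []) g') ∨
      C.triangle = true ∧ ∃ a b c, s a b = 1 ∧ s b c = 1 ∧ s a c = 1 := by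
  simp only [check, Bool.and_eq_true, List.all_eq_true, beq_iff_eq] at hC
  obtain ⟨⟨hT, hB⟩, hE⟩ := hC
  set a : List ℤ := (List.range T.length).map fun i => s v (g i) with ha
  have hal : a.length = T.length := by simp [ha]
  have hav : ∀ i < T.length, a.getD i 0 = s v (g i) := by
    intro i hi
    simp [ha, List.getD_eq_getElem?_getD, hi]
  have hmem : a ∈ signVectors T.length := by
    rw [← hal]
    refine mem_signVectors a fun x hx => ?_
    obtain ⟨i, _, rfl⟩ := List.mem_map.1 hx
    exact hs.range _ _
  have hg' := isEmbedding_extend hs hg hv hal hav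
  have h := hE a hmem
  simp only [checkExtension, Bool.or_eq_true, Bool.and_eq_true] at h
  rcases h with (((h | h) | h) | h) | h
  · obtain ⟨i, hi, hne⟩ := hadj
    simp only [List.all_eq_true, beq_iff_eq] at h
    exact absurd (h _ (List.mem_map.2 ⟨i, List.mem_range.2 hi, rfl⟩)) hne
  · simp only [List.any_eq_true, decide_eq_true_eq] at h
    obtain ⟨y, hy, hlt⟩ := h
    exact absurd (dot_le_of_checkBound hs hT hg hv hal hav (hB y hy)) (by omega)
  · simp only [List.any_eq_true] at h
    obtain ⟨w, _, hw⟩ := h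
    rw [hg'.checkCycle_eq_false hs w] at hw
    exact absurd hw (by simp)
  · simp only [List.any_eq_true] at h
    obtain ⟨t, ht, hiso⟩ := h
    exact Or.inl ⟨t, ht, _, hg'.of_checkIso hiso⟩
  · exact Or.inr ⟨h.1, hg'.exists_triangle h.2⟩

/-- Signed adjacency matrices: the 15 exceptional graphs, then the graphs `Q p q r` with parameters
`(0,0,1)`, `(0,0,2)`, `(0,1,1)`, `(1,0,2)`, `(0,1,2)`, `(2,0,2)`, `(1,1,2)`, `(0,2,2)`. -/
def signTables : List (List (List ℤ)) :=
  [[[0, -1, -1], [-1, 0, 0], [-1, 0, 0]],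
   [[0, -1, 0, -1], [-1, 0, -1, 0], [0, -1, 0, 0], [-1, 0, 0, 0]],
   [[0, -1, -1, 0], [-1, 0, 0, 0], [-1, 0, 0, 1], [0, 0, 1, 0]],
   [[0, -1, 1, 0], [-1, 0, 0, 1], [1, 0, 0, 0], [0, 1, 0, 0]],
   [[0, -1, 1, 0], [-1, 0, 0, 1], [1, 0, 0, 1], [0, 1, 1, 0]],
   [[0, 0, 1, 1], [0, 0, 1, 1], [1, 1, 0, 1], [1, 1, 1, 0]],
   [[0, 1, 1, 0, 0], [1, 0, 0, 1, 0], [1, 0, 0, 0, 1], [0, 1, 0, 0, 1], [0, 0, 1, 1, 0]],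
   [[0, -1, -1, 0, 0], [-1, 0, 0, 1, 0], [-1, 0, 0, 0, 1], [0, 1, 0, 0, 1], [0, 0, 1, 1, 0]],
   [[0, 0, 0, -1, 1], [0, 0, -1, 0, 1], [0, -1, 0, 1, 0], [-1, 0, 1, 0, 0], [1, 1, 0, 0, 0]],
   [[0, 0, 1, 0, 1], [0, 0, 0, 1, 1], [1, 0, 0, 1, 1], [0, 1, 1, 0, 1], [1, 1, 1, 1, 0]],
   [[0, 1, 0, 0, 1], [1, 0, 0, 0, 1], [0, 0, 0, 1, 1], [0, 0, 1, 0, 1], [1, 1, 1, 1, 0]],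
   [[0, -1, 0, 0, 1], [-1, 0, 1, 1, 0], [0, 1, 0, 1, 1], [0, 1, 1, 0, 1], [1, 0, 1, 1, 0]],
   [[0, 1, 1, 0, 0, 1], [1, 0, 0, 1, 0, 1], [1, 0, 0, 0, 1, 1], [0, 1, 0, 0, 1, 1], [0, 0, 1, 1, 0,
     1], [1, 1, 1, 1, 1, 0]],
   [[0, 0, 0, 1, 1, 0], [0, 0, 0, 1, 0, 1], [0, 0, 0, 0, 1, 1], [1, 1, 0, 0, 1, 1], [1, 0, 1, 1, 0,
     1], [0, 1, 1, 1, 1, 0]],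
   [[0, 1, 0, 0, 0, 1], [1, 0, 0, 0, 0, 1], [0, 0, 0, 1, 1, 1], [0, 0, 1, 0, 1, 1], [0, 0, 1, 1, 0,
     1], [1, 1, 1, 1, 1, 0]],
   [[0]],
   [[0, 1], [1, 0]],
   [[0, -1], [-1, 0]],
   [[0, 1, 0], [1, 0, 1], [0, 1, 0]],
   [[0, -1, 0], [-1, 0, 1], [0, 1, 0]],
   [[0, 1, 0, 0], [1, 0, 1, 0], [0, 1, 0, 1], [0, 0, 1, 0]],
   [[0, 1, 0, 0], [1, 0, 1, 0], [0, 1, 0, -1], [0, 0, -1, 0]],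
   [[0, -1, 0, 0], [-1, 0, 1, 0], [0, 1, 0, -1], [0, 0, -1, 0]]]

/-- Certificates for the one-vertex extensions of `signTables`; targets are positions there. -/
def signCertificates : List ExtensionCertificate :=
  [{ bounds := [([2, 1, 1], 1)]
     cycles := [[0, 0, 0, 1, 3], [0, 0, 0, 3, 1], [0, 0, 2, 1, 3], [0, 0, 0, 1, 2], [0, 0, 0, 2, 1],
       [0, 0, 3, 1, 2]]
     targets := [(2, [1, 2, 3, 0]), (1, [1, 3, 0, 2]), (2, [1, 3, 2, 0]), (1, [1, 2, 0, 3])]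
     triangle := false },
   { bounds := [([3, 3, 2, 2], 0), ([1, 0, 0, 1], 1)]
     cycles := [[0, 0, 0, 2, 1], [0, 0, 0, 1, 2], [0, 4, 1, 2, 3], [0, 3, 2, 1, 4]]
     targets := []
     triangle := false },
   { bounds := [([3, 2, 3, -2], 0), ([0, 0, 1, -1], 1)]
     cycles := [[0, 0, 0, 3, 1], [0, 0, 0, 1, 3], [3, 1, 2, 0, 4]]
     targets := [(7, [1, 2, 3, 0, 4])]
     triangle := false },
   { bounds := [([3, 3, -2, -2], 0), ([1, 0, -1, 0], 1)]
     cycles := [[0, 0, 0, 1, 2], [0, 0, 0, 2, 1]]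
     targets := [(8, [0, 1, 2, 4, 3]), (8, [0, 2, 1, 3, 4])]
     triangle := false },
   { bounds := [([2, 1, -2, 1], 1), ([1, 2, 1, -2], 1), ([2, 2, -1, -1], 1), ([1, -1, -2, 2], 1)]
     cycles := [[0, 0, 0, 2, 1], [3, 0, 0, 0, 4], [0, 0, 0, 1, 2]]
     targets := [(11, [1, 2, 0, 4, 3]), (11, [2, 1, 0, 3, 4])]
     triangle := false },
   { bounds := [([1, 1, -1, -1], 0), ([0, 0, 1, -1], 1), ([2, 2, -1, -1], 1)]
     cycles := [[2, 0, 0, 0, 3], [1, 0, 0, 0, 4], [1, 0, 0, 0, 3], [2, 0, 0, 0, 4]]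
     targets := [(9, [0, 1, 2, 3, 4]), (9, [0, 1, 2, 4, 3]), (9, [0, 2, 1, 3, 4]), (9, [0, 2, 1, 4,
       3]), (11, [0, 2, 3, 4, 1]), (11, [0, 1, 3, 4, 2])]
     triangle := false },
   { bounds := [([3, -1, -4, -1, 3], 0), ([1, -2, 0, 2, -1], 0)]
     cycles := [[1, 0, 0, 0, 2]]
     targets := [(12, [1, 2, 3, 4, 5, 0])]
     triangle := false },
   { bounds := [([1, 3, -1, -4, 3], 0), ([2, 1, 2, 0, -1], 0)]
     cycles := [[0, 0, 0, 1, 2], [0, 0, 0, 2, 1]]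
     targets := []
     triangle := false },
   { bounds := [([4, 1, -1, 3, -3], 0), ([0, 2, 2, -1, -1], 0)]
     cycles := [[0, 0, 0, 4, 1], [0, 0, 0, 2, 3]]
     targets := []
     triangle := false },
   { bounds := [([2, -2, -3, 3, 0], 0), ([0, 1, 1, -1, -1], 0), ([0, 0, 0, 1, -1], 1), ([2, 1, 0, 1,
     -1], 2)]
     cycles := [[3, 0, 0, 0, 4], [1, 0, 0, 0, 5]]
     targets := [(13, [0, 1, 2, 3, 4, 5]), (12, [0, 1, 2, 3, 4, 5])]
     triangle := false },
   { bounds := [([2, 2, 2, 2, -5], 1), ([1, -2, 1, -1, 0], 2), ([1, -1, -2, 1, 0], 2), ([2, -1, 1,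
     -1, 0], 2), ([1, -1, -1, 2, 0], 2), ([2, 0, 1, 1, -1], 2), ([1, 1, 0, 2, -1], 2), ([1, 1, 2,
     -1, 0], 3), ([0, 2, 1, 1, -1], 2)]
     cycles := [[1, 0, 0, 0, 2], [3, 0, 0, 0, 4]]
     targets := [(14, [1, 2, 0, 3, 4, 5]), (14, [3, 4, 0, 1, 2, 5])]
     triangle := false },
   { bounds := [([0, 1, -1, -1, 1], 0), ([2, 1, 0, 1, -2], 1), ([1, 1, 1, -1, -1], 1), ([2, 1, 1,
     -1, 0], 2), ([2, 1, -1, 1, 0], 2), ([2, 0, -1, 1, -1], 2), ([2, 0, 1, -1, -1], 2), ([0, 2, -1,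
     -1, 2], 1)]
     cycles := [[0, 0, 0, 1, 2], [0, 0, 0, 2, 1]]
     targets := []
     triangle := false },
   { bounds := [([1, -4, 1, 4, -4, 1], 0), ([3, -2, -3, 0, 2, 0], 0)]
     cycles := []
     targets := []
     triangle := false },
   { bounds := [([1, 1, -2, -3, 1, 2], 0), ([1, -1, -1, -1, -1, 2], 0), ([3, -3, 3, 3, -8, 3], 1)]
     cycles := []
     targets := []
     triangle := false },
   { bounds := [([3, 3, 2, 2, 2, -8], 1), ([2, 2, 0, 2, 2, -5], 1), ([0, 0, 1, -1, 2, -1], 2), ([2,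
     0, 1, 1, 0, -2], 1), ([0, 2, 1, 1, 0, -2], 1), ([0, 0, 1, -2, 1, 1], 2), ([0, 0, 2, -1, -1,
     -1], 2), ([1, 0, -1, -1, 2, 0], 2), ([0, 1, 2, -1, -1, 0], 2), ([0, 0, 1, -2, 1, -1], 2), ([0,
     0, 1, 1, 1, -2], 2), ([1, 0, 1, -1, 1, -1], 1), ([0, 1, 1, -1, 1, -1], 1)]
     cycles := []
     targets := []
     triangle := false },
   { bounds := []
     cycles := []
     targets := [(16, [0, 1]), (17, [0, 1])]
     triangle := false },
   { bounds := [([1, -1], 1)]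
     cycles := [[1, 0, 0, 0, 2]]
     targets := [(18, [0, 2, 1]), (19, [0, 2, 1]), (18, [0, 1, 2]), (19, [0, 1, 2])]
     triangle := true },
   { bounds := [([1, 1], 1)]
     cycles := [[0, 0, 0, 1, 2], [0, 0, 0, 2, 1]]
     targets := [(19, [1, 2, 0]), (0, [2, 0, 1]), (19, [2, 1, 0]), (0, [1, 0, 2])]
     triangle := false },
   { bounds := [([1, -2, 1], 1)]
     cycles := [[2, 0, 0, 0, 3], [1, 0, 0, 0, 2]]
     targets := [(20, [0, 3, 2, 1]), (21, [1, 2, 3, 0]), (20, [0, 1, 2, 3]), (4, [0, 3, 1, 2]), (5,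
       [1, 3, 0, 2]), (21, [3, 2, 1, 0]), (4, [0, 1, 3, 2])]
     triangle := true },
   { bounds := [([1, 2, -1], 1)]
     cycles := [[2, 0, 0, 0, 3], [0, 0, 0, 1, 2], [2, 1, 0, 0, 3], [0, 0, 0, 2, 1]]
     targets := [(21, [0, 3, 2, 1]), (22, [0, 3, 2, 1]), (3, [1, 2, 0, 3]), (4, [1, 2, 0, 3]), (2,
       [1, 0, 2, 3])]
     triangle := true },
   { bounds := [([2, -3, 3, -2], 0), ([0, 0, 1, -1], 1)]
     cycles := [[2, 0, 0, 0, 3]]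
     targets := [(6, [0, 1, 4, 2, 3]), (9, [1, 4, 2, 3, 0]), (7, [0, 1, 4, 2, 3])]
     triangle := true },
   { bounds := [([2, -3, 3, 2], 0), ([0, 0, 1, 1], 1)]
     cycles := [[2, 0, 0, 0, 3], [0, 0, 0, 4, 3]]
     targets := [(7, [4, 0, 3, 1, 2]), (8, [1, 3, 4, 0, 2])]
     triangle := true },
   { bounds := [([2, 3, -3, -2], 0), ([0, 0, 1, 1], 1)]
     cycles := [[2, 0, 0, 0, 3], [2, 1, 0, 4, 3]]
     targets := [(8, [1, 4, 3, 2, 0])]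
     triangle := true }]

theorem check_signTables : ∀ k < 23,
    check signTables (signTables.getD k []) (signCertificates.getD k ⟨[], [], [], false⟩) = true :=
      by
  decide +kernel

end SignTable

/-! ### Spanning embeddings of the small tables -/

namespace SignTable

theorem targets_signCertificates : ∀ k < 23,
    let C := signCertificates.getD k ⟨[], [], [], false⟩
    (k < 15 → C.triangle = false) ∧ 0 < (signTables.getD k []).length ∧ ∀ t ∈ C.targets,
      t.1 < 23 ∧ (k < 15 → t.1 < 15) ∧
        (signTables.getD t.1 []).length = (signTables.getD k []).length + 1 := by
  decide +kernel

/-- No nonempty proper subset of the vertices is separated from its complement. -/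
def IsConnected {V : Type*} (s : V → V → ℤ) : Prop :=
  ∀ X : Set V, X.Nonempty → X ≠ Set.univ → ∃ u ∈ X, ∃ v ∉ X, s v u ≠ 0

theorem IsEmbedding.length_le {V : Type*} [Fintype V] {s : V → V → ℤ} {T : List (List ℤ)}
    {g : ℕ → V} (hg : IsEmbedding s T g) : T.length ≤ Fintype.card V := by
  simpa using Fintype.card_le_of_injective (fun i : Fin T.length => g i)
    fun i j h => Fin.ext (hg.inj i i.2 j j.2 h)

theorem exists_spanning_or_triangle {V : Type*} [Fintype V] {s : V → V → ℤ}
    (hs : GoldenSigning s) (hc : IsConnected s) {k : ℕ} (hk : k < 23) {g : ℕ → V}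
    (hg : IsEmbedding s (signTables.getD k []) g) :
    (∃ k' < 23, (k < 15 → k' < 15) ∧ ∃ g', IsEmbedding s (signTables.getD k' []) g' ∧
      ∀ v, ∃ i < (signTables.getD k' []).length, g' i = v) ∨
    15 ≤ k ∧ ∃ a b c, s a b = 1 ∧ s b c = 1 ∧ s a c = 1 := by
  induction hm : Fintype.card V - (signTables.getD k []).length using Nat.strong_induction_on
    generalizing k g with
  | _ m ih =>
  obtain ⟨htri, hpos, htgt⟩ := targets_signCertificates k hk
  by_cases hsurj : ∀ v, ∃ i < (signTables.getD k []).length, g i = v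
  · exact Or.inl ⟨k, hk, id, g, hg, hsurj⟩
  push Not at hsurj
  obtain ⟨v₀, hv₀⟩ := hsurj
  obtain ⟨u, ⟨i, hi, rfl⟩, v, hv, hvu⟩ := hc {v | ∃ i < (signTables.getD k []).length, g i = v}
    ⟨g 0, 0, hpos, rfl⟩ (fun h => by
      obtain ⟨i, hi, e⟩ := h.symm ▸ Set.mem_univ v₀
      exact hv₀ i hi e)
  have hv' : ∀ i < (signTables.getD k []).length, g i ≠ v := fun i hi e => hv ⟨i, hi, e⟩
  rcases exists_target_of_check hs (check_signTables k hk) hg hv' ⟨i, hi, hvu⟩ with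
    ⟨t, ht, g', hg'⟩ | ⟨ht, htr⟩
  · obtain ⟨h1, h2, h3⟩ := htgt t ht
    have hle := hg'.length_le
    rcases ih _ (by omega) h1 hg' rfl with ⟨k', hk', hkk, hrest⟩ | ⟨hge, htr⟩
    · exact Or.inl ⟨k', hk', fun h => hkk (h2 h), hrest⟩
    · exact Or.inr ⟨by by_contra h; exact absurd (h2 (by omega)) (by omega), htr⟩
  · refine Or.inr ⟨?_, htr⟩
    by_contra h
    rw [htri (by omega)] at ht
    exact absurd ht (by simp)

end SignTable

/-! ### Isomorphisms of edge-signed graphs -/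

namespace EdgeSignedGraph

variable {V W : Type*}

open Classical in
/-- The signed adjacency matrix. -/
def sign (S : EdgeSignedGraph V) (u v : V) : ℤ :=
  if S.pos.Adj u v then 1 else if S.neg.Adj u v then -1 else 0

theorem sign_eq_one_iff (S : EdgeSignedGraph V) (u v : V) : S.sign u v = 1 ↔ S.pos.Adj u v := by
  unfold sign; split_ifs <;> simp_all

theorem sign_eq_neg_one_iff (S : EdgeSignedGraph V) (u v : V) :
    S.sign u v = -1 ↔ S.neg.Adj u v := by
  have := S.disjoint u v
  unfold sign; split_ifs <;> simp_all

theorem sign_comm (S : EdgeSignedGraph V) (u v : V) : S.sign u v = S.sign v u := by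
  by_cases h1 : S.pos.Adj u v <;> by_cases h2 : S.neg.Adj u v <;>
    simp [sign, h1, h2, S.pos.adj_comm v u, S.neg.adj_comm v u]

theorem sign_self (S : EdgeSignedGraph V) (v : V) : S.sign v v = 0 := by simp [sign]

theorem sign_range (S : EdgeSignedGraph V) (u v : V) :
    S.sign u v = 0 ∨ S.sign u v = 1 ∨ S.sign u v = -1 := by
  unfold sign; split_ifs <;> simp

theorem Isomorphic.of_sign (S : EdgeSignedGraph V) (T : EdgeSignedGraph W) (φ : W → V)
    (hφ : Function.Bijective φ)
    (h : ∀ a b, (T.pos.Adj a b ↔ S.sign (φ a) (φ b) = 1) ∧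
      (T.neg.Adj a b ↔ S.sign (φ a) (φ b) = -1)) : S.Isomorphic T := by
  refine ⟨(Equiv.ofBijective φ hφ).symm, fun u v => ?_⟩
  obtain ⟨a, rfl⟩ := hφ.2 u
  obtain ⟨b, rfl⟩ := hφ.2 v
  have ha : (Equiv.ofBijective φ hφ).symm (φ a) = a := (Equiv.ofBijective φ hφ).symm_apply_apply a
  have hb : (Equiv.ofBijective φ hφ).symm (φ b) = b := (Equiv.ofBijective φ hφ).symm_apply_apply b
  rw [ha, hb, (h a b).1, (h a b).2, sign_eq_one_iff, sign_eq_neg_one_iff]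
  exact ⟨Iff.rfl, Iff.rfl⟩

open SignTable in
theorem Isomorphic.of_spanning (S : EdgeSignedGraph V) (E : EdgeSignedGraph W)
    {L : List (List ℤ)} {g : ℕ → V} (hg : IsEmbedding S.sign L g)
    (hsurj : ∀ v, ∃ i < L.length, g i = v) (idx : W → ℕ) (hlt : ∀ w, idx w < L.length)
    (hinj : Function.Injective idx) (hidx : ∀ i < L.length, ∃ w, idx w = i)
    (h : ∀ a b, (E.pos.Adj a b ↔ entry L (idx a) (idx b) = 1) ∧
      (E.neg.Adj a b ↔ entry L (idx a) (idx b) = -1)) : S.Isomorphic E := by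
  refine Isomorphic.of_sign S E (fun w => g (idx w)) ⟨fun a b hab => ?_, fun v => ?_⟩ fun a b => ?_
  · exact hinj (hg.inj _ (hlt a) _ (hlt b) hab)
  · obtain ⟨i, hi, rfl⟩ := hsurj v
    obtain ⟨w, rfl⟩ := hidx i hi
    exact ⟨w, rfl⟩
  · rw [hg.sign _ (hlt a) _ (hlt b)]
    exact h a b

open SignTable in
theorem isExceptional_of_spanning (S : EdgeSignedGraph V) {k : ℕ} (hk : k < 15) {g : ℕ → V}
    (hg : IsEmbedding S.sign (signTables.getD k []) g)
    (hsurj : ∀ v, ∃ i < (signTables.getD k []).length, g i = v) : S.IsExceptional := by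
  have key : ∀ {n : ℕ} (P N : Finset (Sym2 (Fin n))) (h : Disjoint P N),
      (signTables.getD k []).length = n →
      (∀ a b : Fin n, ((s(a, b) ∈ P ∧ a ≠ b) ↔ entry (signTables.getD k []) a b = 1) ∧
        ((s(a, b) ∈ N ∧ a ≠ b) ↔ entry (signTables.getD k []) a b = -1)) →
      S.Isomorphic (ofEdges n P N h) := by
    intro n P N h hn hab
    refine Isomorphic.of_spanning S _ hg hsurj (fun i : Fin n => (i : ℕ)) (fun w => hn ▸ w.2)
      Fin.val_injective (fun i hi => ⟨⟨i, hn ▸ hi⟩, rfl⟩) fun a b => ?_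
    simp only [ofEdges, SimpleGraph.fromEdgeSet_adj, Finset.mem_coe]
    exact hab a b
  unfold IsExceptional
  interval_cases k
  · exact Or.inl (key _ _ _ rfl (by decide))
  · exact Or.inr <| Or.inl (key _ _ _ rfl (by decide))
  · exact Or.inr <| Or.inr <| Or.inl (key _ _ _ rfl (by decide))
  · exact Or.inr <| Or.inr <| Or.inr <| Or.inl (key _ _ _ rfl (by decide))
  · iterate 4 right
    exact Or.inl (key _ _ _ rfl (by decide))
  · iterate 5 right
    exact Or.inl (key _ _ _ rfl (by decide))
  · iterate 6 right
    exact Or.inl (key _ _ _ rfl (by decide))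
  · iterate 7 right
    exact Or.inl (key _ _ _ rfl (by decide))
  · iterate 8 right
    exact Or.inl (key _ _ _ rfl (by decide))
  · iterate 9 right
    exact Or.inl (key _ _ _ rfl (by decide))
  · iterate 10 right
    exact Or.inl (key _ _ _ rfl (by decide))
  · iterate 11 right
    exact Or.inl (key _ _ _ rfl (by decide))
  · iterate 12 right
    exact Or.inl (key _ _ _ rfl (by decide +kernel))
  · iterate 13 right
    exact Or.inl (key _ _ _ rfl (by decide +kernel))
  · iterate 14 right
    exact key _ _ _ rfl (by decide +kernel)

end EdgeSignedGraph

namespace EdgeSignedGraph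

variable {V : Type*}

/-- Numbering of the vertices of `Q p q r` by a list, in the order of the summands. -/
def indexQ (p q r : ℕ) (l : List ℕ) : Fin p ⊕ Fin q ⊕ Fin r → ℕ
  | .inl i => l.getD i 0
  | .inr (.inl j) => l.getD (p + j) 0
  | .inr (.inr k) => l.getD (p + q + k) 0

instance decidableRel_pos_Q (p q r : ℕ) (h : p + q ≤ r) : DecidableRel (Q p q r h).pos.Adj := by
  rintro (i | j | k) (i' | j' | k') <;> simp only [Q, SimpleGraph.fromRel_adj] <;> infer_instance

instance decidableRel_neg_Q (p q r : ℕ) (h : p + q ≤ r) : DecidableRel (Q p q r h).neg.Adj := by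
  rintro (i | j | k) (i' | j' | k') <;> simp only [Q, SimpleGraph.fromRel_adj] <;> infer_instance

open SignTable in
theorem exists_isomorphic_Q_of_spanning (S : EdgeSignedGraph V) {k : ℕ} (hk : 15 ≤ k)
    (hk' : k < 23) {g : ℕ → V} (hg : IsEmbedding S.sign (signTables.getD k []) g)
    (hsurj : ∀ v, ∃ i < (signTables.getD k []).length, g i = v) :
    ∃ (p q r : ℕ) (h : p + q ≤ r), S.Isomorphic (Q p q r h) := by
  have key : ∀ (p q r : ℕ) (h : p + q ≤ r) (l : List ℕ),
      (∀ w, indexQ p q r l w < (signTables.getD k []).length) →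
      (∀ a b, indexQ p q r l a = indexQ p q r l b → a = b) →
      (∀ i < (signTables.getD k []).length, ∃ w, indexQ p q r l w = i) →
      (∀ a b, ((Q p q r h).pos.Adj a b ↔
          entry (signTables.getD k []) (indexQ p q r l a) (indexQ p q r l b) = 1) ∧
        ((Q p q r h).neg.Adj a b ↔
          entry (signTables.getD k []) (indexQ p q r l a) (indexQ p q r l b) = -1)) →
      ∃ (p q r : ℕ) (h : p + q ≤ r), S.Isomorphic (Q p q r h) :=
    fun p q r h l h1 h2 h3 h4 =>
      ⟨p, q, r, h, Isomorphic.of_spanning S _ hg hsurj (indexQ p q r l) h1 h2 h3 h4⟩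
  interval_cases k
  · exact key 0 0 1 (by decide) [0] (by decide) (by decide) (by decide) (by decide)
  · exact key 0 0 2 (by decide) [0, 1] (by decide) (by decide) (by decide) (by decide)
  · exact key 0 1 1 (by decide) [0, 1] (by decide) (by decide) (by decide) (by decide)
  · exact key 1 0 2 (by decide) [0, 1, 2] (by decide) (by decide) (by decide) (by decide)
  · exact key 0 1 2 (by decide) [0, 1, 2] (by decide) (by decide) (by decide) (by decide)
  · exact key 2 0 2 (by decide) [0, 3, 1, 2] (by decide) (by decide) (by decide) (by decide)
  · exact key 1 1 2 (by decide) [0, 3, 1, 2] (by decide) (by decide) (by decide) (by decide)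
  · exact key 0 2 2 (by decide) [0, 3, 1, 2] (by decide) (by decide) (by decide) (by decide)

/-- A positive clique with at most one pendant edge at each of its vertices is some `Q p q r`. -/
theorem exists_isomorphic_Q_of_clique [Finite V] (S : EdgeSignedGraph V) (R : Set V) (m : V → V)
    (hR : ∀ u ∈ R, ∀ v ∈ R, u ≠ v → S.sign u v = 1)
    (hm : ∀ v ∉ R, m v ∈ R ∧ S.sign v (m v) ≠ 0)
    (hm' : ∀ v ∉ R, ∀ a ∈ R, S.sign v a ≠ 0 → a = m v)
    (hinj : ∀ v ∉ R, ∀ w ∉ R, m v = m w → v = w)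
    (hzero : ∀ v ∉ R, ∀ w ∉ R, S.sign v w = 0) :
    ∃ (p q r : ℕ) (h : p + q ≤ r), S.Isomorphic (Q p q r h) := by
  obtain ⟨p, ⟨eP⟩⟩ := Finite.exists_equiv_fin {v // v ∉ R ∧ S.sign v (m v) = 1}
  obtain ⟨q, ⟨eN⟩⟩ := Finite.exists_equiv_fin {v // v ∉ R ∧ S.sign v (m v) = -1}
  obtain ⟨t, ⟨eT⟩⟩ := Finite.exists_equiv_fin {v // v ∈ R ∧ ∀ w ∉ R, m w ≠ v}
  let xP : Fin p → V := fun i => (eP.symm i).1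
  let xN : Fin q → V := fun i => (eN.symm i).1
  let xT : Fin t → V := fun i => (eT.symm i).1
  have hP : ∀ i, xP i ∉ R ∧ S.sign (xP i) (m (xP i)) = 1 := fun i => (eP.symm i).2
  have hN : ∀ i, xN i ∉ R ∧ S.sign (xN i) (m (xN i)) = -1 := fun i => (eN.symm i).2
  have hT : ∀ i, xT i ∈ R ∧ ∀ w ∉ R, m w ≠ xT i := fun i => (eT.symm i).2
  have iP : Function.Injective xP := Subtype.val_injective.comp eP.symm.injective
  have iN : Function.Injective xN := Subtype.val_injective.comp eN.symm.injective
  have iT : Function.Injective xT := Subtype.val_injective.comp eT.symm.injective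
  have iPN : ∀ i j, xP i ≠ xN j := fun i j h => by
    have h1 := (hP i).2
    rw [h, (hN j).2] at h1
    exact absurd h1 (by decide)
  let ρ : (Fin p ⊕ Fin q) ⊕ Fin t → V :=
    Sum.elim (Sum.elim (fun i => m (xP i)) (fun j => m (xN j))) xT
  have hρR : ∀ k, ρ k ∈ R := by
    rintro ((i | j) | k)
    · exact (hm _ (hP i).1).1
    · exact (hm _ (hN j).1).1
    · exact (hT k).1
  have hρ : Function.Injective ρ := by
    rintro ((i | j) | k) ((i' | j') | k') h
    · rw [iP (hinj _ (hP i).1 _ (hP i').1 h)]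
    · exact absurd (hinj _ (hP i).1 _ (hN j').1 h) (iPN i j')
    · exact absurd h ((hT k').2 _ (hP i).1)
    · exact absurd (hinj _ (hN j).1 _ (hP i').1 h).symm (iPN i' j)
    · rw [iN (hinj _ (hN j).1 _ (hN j').1 h)]
    · exact absurd h ((hT k').2 _ (hN j).1)
    · exact absurd h.symm ((hT k).2 _ (hP i').1)
    · exact absurd h.symm ((hT k).2 _ (hN j').1)
    · rw [iT h]
  have surjOut : ∀ v ∉ R, (∃ i, xP i = v) ∨ ∃ j, xN j = v := by
    intro v hv
    have h0 := (hm v hv).2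
    rcases (S.sign_range v (m v)).resolve_left h0 with h | h
    · exact Or.inl ⟨eP ⟨v, hv, h⟩, by simp [xP]⟩
    · exact Or.inr ⟨eN ⟨v, hv, h⟩, by simp [xN]⟩
  have hρs : ∀ v ∈ R, ∃ k, ρ k = v := by
    intro v hv
    by_cases h : ∃ w ∉ R, m w = v
    · obtain ⟨w, hw, rfl⟩ := h
      rcases surjOut w hw with ⟨i, rfl⟩ | ⟨j, rfl⟩
      · exact ⟨.inl (.inl i), rfl⟩
      · exact ⟨.inl (.inr j), rfl⟩
    · push Not at h
      exact ⟨.inr (eT ⟨v, hv, h⟩), by simp [ρ, xT]⟩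
  let ψ : (Fin p ⊕ Fin q) ⊕ Fin t ≃ Fin (p + q + t) :=
    (Equiv.sumCongr finSumFinEquiv (Equiv.refl _)).trans finSumFinEquiv
  have hψP : ∀ i : Fin p, ψ (.inl (.inl i)) = ⟨i.1, by omega⟩ := fun i => by
    apply Fin.ext; simp [ψ]
  have hψN : ∀ j : Fin q, ψ (.inl (.inr j)) = ⟨p + j.1, by omega⟩ := fun j => by
    apply Fin.ext; simp [ψ]
  have sP : ∀ i k, S.sign (xP i) (ρ k) = if k = .inl (.inl i) then 1 else 0 := by
    intro i k
    split_ifs with h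
    · rw [h]; exact (hP i).2
    · by_contra h0
      exact h (hρ (hm' _ (hP i).1 _ (hρR k) h0))
  have sN : ∀ j k, S.sign (xN j) (ρ k) = if k = .inl (.inr j) then -1 else 0 := by
    intro j k
    split_ifs with h
    · rw [h]; exact (hN j).2
    · by_contra h0
      exact h (hρ (hm' _ (hN j).1 _ (hρR k) h0))
  have sR : ∀ k k', S.sign (ρ k) (ρ k') = if k = k' then 0 else 1 := by
    intro k k'
    split_ifs with h
    · rw [h, S.sign_self]
    · exact hR _ (hρR k) _ (hρR k') fun e => h (hρ e)
  refine ⟨p, q, p + q + t, by omega, Isomorphic.of_sign S _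
    (Sum.elim xP (Sum.elim xN fun k => ρ (ψ.symm k))) ⟨?_, ?_⟩ ?_⟩
  · rintro (i | j | k) (i' | j' | k') h <;> simp only [Sum.elim_inl, Sum.elim_inr] at h
    · rw [iP h]
    · exact absurd h (iPN _ _)
    · exact absurd (h ▸ hρR _) (hP i).1
    · exact absurd h.symm (iPN _ _)
    · rw [iN h]
    · exact absurd (h ▸ hρR _) (hN j).1
    · exact absurd (h ▸ hρR _) (hP i').1
    · exact absurd (h ▸ hρR _) (hN j').1
    · rw [ψ.symm.injective (hρ h)]
  · intro v
    by_cases hv : v ∈ R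
    · obtain ⟨k, rfl⟩ := hρs v hv
      exact ⟨.inr (.inr (ψ k)), by simp⟩
    · rcases surjOut v hv with ⟨i, rfl⟩ | ⟨j, rfl⟩
      · exact ⟨.inl i, rfl⟩
      · exact ⟨.inr (.inl j), rfl⟩
  · rintro (i | j | k) (i' | j' | k') <;>
      simp only [Sum.elim_inl, Sum.elim_inr, Q, SimpleGraph.fromRel_adj]
    · simp [hzero _ (hP i).1 _ (hP i').1]
    · simp [hzero _ (hP i).1 _ (hN j').1]
    · simp [sP, ← hψP, ψ.symm_apply_eq]
      split_ifs <;> decide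
    · simp [hzero _ (hN j).1 _ (hP i').1]
    · simp [hzero _ (hN j).1 _ (hN j').1]
    · simp [sN, ← hψN, ψ.symm_apply_eq]
      split_ifs <;> decide
    · simp [S.sign_comm _ (xP i'), sP, ← hψP, ψ.symm_apply_eq]
      split_ifs <;> decide
    · simp [S.sign_comm _ (xN j'), sN, ← hψN, ψ.symm_apply_eq]
      split_ifs <;> decide
    · simp [sR]
      split_ifs <;> decide

end EdgeSignedGraph

/-! ### Signed graphs with a positive triangle -/

namespace GoldenSigning

open SignTable

variable {V : Type*} {s : V → V → ℤ}

theorem ne_of_sign (hs : GoldenSigning s) {a b : V} (h : s a b ≠ 0) : a ≠ b := by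
  rintro rfl; exact h (hs.diag a)

theorem nonneg_three (hs : GoldenSigning s) {a b c : V} (hab : a ≠ b) (hac : a ≠ c) (hbc : b ≠ c)
    (x y z : ℝ) : 0 ≤ 2 * (x * y * s a b + x * z * s a c + y * z * s b c)
      + Real.goldenRatio * (x ^ 2 + y ^ 2 + z ^ 2) := by
  have h := hs.nonneg 3 ![a, b, c] (by
    intro i j; fin_cases i <;> fin_cases j <;> simp [hab, hac, hbc, hab.symm, hac.symm, hbc.symm])
    ![x, y, z]
  simp [Fin.sum_univ_succ, hs.diag, hs.symm b a, hs.symm c a, hs.symm c b] at h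
  linarith

theorem nonneg_four (hs : GoldenSigning s) {a b c d : V} (hab : a ≠ b) (hac : a ≠ c) (had : a ≠ d)
    (hbc : b ≠ c) (hbd : b ≠ d) (hcd : c ≠ d) (x y z w : ℝ) :
    0 ≤ 2 * (x * y * s a b + x * z * s a c + x * w * s a d + y * z * s b c + y * w * s b d
      + z * w * s c d) + Real.goldenRatio * (x ^ 2 + y ^ 2 + z ^ 2 + w ^ 2) := by
  have h := hs.nonneg 4 ![a, b, c, d] (by
    intro i j; fin_cases i <;> fin_cases j <;> simp [hab, hac, hbc, hab.symm, hac.symm, hbc.symm,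
      had, hbd, hcd, had.symm, hbd.symm, hcd.symm])
    ![x, y, z, w]
  simp [Fin.sum_univ_succ, hs.diag, hs.symm b a, hs.symm c a, hs.symm c b, hs.symm d a,
    hs.symm d b, hs.symm d c] at h
  linarith

theorem nonneg_five (hs : GoldenSigning s) {a b c d e : V} (hab : a ≠ b) (hac : a ≠ c)
    (had : a ≠ d) (hae : a ≠ e) (hbc : b ≠ c) (hbd : b ≠ d) (hbe : b ≠ e) (hcd : c ≠ d)
    (hce : c ≠ e) (hde : d ≠ e) (x y z w t : ℝ) :
    0 ≤ 2 * (x * y * s a b + x * z * s a c + x * w * s a d + x * t * s a e + y * z * s b c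
      + y * w * s b d + y * t * s b e + z * w * s c d + z * t * s c e + w * t * s d e)
      + Real.goldenRatio * (x ^ 2 + y ^ 2 + z ^ 2 + w ^ 2 + t ^ 2) := by
  have h := hs.nonneg 5 ![a, b, c, d, e] (by
    intro i j; fin_cases i <;> fin_cases j <;> simp [hab, hac, hbc, hab.symm, hac.symm, hbc.symm,
      had, hbd, hcd, had.symm, hbd.symm, hcd.symm, hae, hbe, hce, hde, hae.symm, hbe.symm,
      hce.symm, hde.symm])
    ![x, y, z, w, t]
  simp [Fin.sum_univ_succ, hs.diag, hs.symm b a, hs.symm c a, hs.symm c b, hs.symm d a,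
    hs.symm d b, hs.symm d c, hs.symm e a, hs.symm e b, hs.symm e c, hs.symm e d] at h
  linarith

/-- All triangles are positive. -/
theorem triangle_pos (hs : GoldenSigning s) {a b c : V} (hab : s a b ≠ 0) (hac : s a c ≠ 0)
    (hbc : s b c ≠ 0) : s a b = 1 := by
  have h := hs.nonneg_three (hs.ne_of_sign hab) (hs.ne_of_sign hac) (hs.ne_of_sign hbc)
  have g := goldenRatio_lt
  have g' := goldenRatio_gt
  refine ((hs.range a b).resolve_left hab).resolve_right fun e1 => ?_
  rcases (hs.range a c).resolve_left hac with e2 | e2 <;>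
    rcases (hs.range b c).resolve_left hbc with e3 | e3
  · have := h 1 1 (-1)
    rw [e1, e2, e3] at this; push_cast at this; linarith
  · exact hs.no_cycle (Or.inr e1) (Or.inr e3) (Or.inl rfl) (Or.inl rfl) e2
  · exact hs.no_cycle (Or.inr ((hs.symm b a).trans e1)) (Or.inr e2) (Or.inl rfl) (Or.inl rfl) e3
  · have := h 1 1 1
    rw [e1, e2, e3] at this; push_cast at this; linarith

theorem no_claw (hs : GoldenSigning s) {a b c d : V} (hab : s a b ≠ 0) (hac : s a c ≠ 0)
    (had : s a d ≠ 0) (hbc : b ≠ c) (hbd : b ≠ d) (hcd : c ≠ d) (ebc : s b c = 0) (ebd : s b d = 0)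
    (ecd : s c d = 0) : False := by
  have h := hs.nonneg_four (hs.ne_of_sign hab) (hs.ne_of_sign hac) (hs.ne_of_sign had) hbc hbd hcd
    7 (-4 * s a b) (-4 * s a c) (-4 * s a d)
  have g := goldenRatio_lt
  rcases (hs.range a b).resolve_left hab with e1 | e1 <;>
    rcases (hs.range a c).resolve_left hac with e2 | e2 <;>
    rcases (hs.range a d).resolve_left had with e3 | e3 <;>
    · rw [e1, e2, e3, ebc, ebd, ecd] at h; push_cast at h; linarith

/-- Four-cycles without chords are negative. -/
theorem square_neg (hs : GoldenSigning s) {a b c d : V} (hab : s a b ≠ 0) (hbc : s b c ≠ 0)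
    (hcd : s c d ≠ 0) (hda : s d a ≠ 0) (hac : a ≠ c) (hbd : b ≠ d) (eac : s a c = 0)
    (ebd : s b d = 0) : s a b * s b c * s c d * s d a = -1 := by
  have h := hs.nonneg_four (hs.ne_of_sign hab) hac (hs.ne_of_sign hda).symm (hs.ne_of_sign hbc)
    hbd (hs.ne_of_sign hcd) 1 (-s a b) (s a b * s b c) (-s d a)
  have g := goldenRatio_lt
  rw [hs.symm a d] at h
  rcases (hs.range a b).resolve_left hab with e1 | e1 <;>
    rcases (hs.range b c).resolve_left hbc with e2 | e2 <;>
    rcases (hs.range c d).resolve_left hcd with e3 | e3 <;>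
    rcases (hs.range d a).resolve_left hda with e4 | e4 <;>
    first
    | (rw [e1, e2, e3, e4]; rfl)
    | (rw [e1, e2, e3, e4, eac, ebd] at h; push_cast at h; linarith)

/-- A triangle has no pendant path of length two. -/
theorem no_tailed_triangle (hs : GoldenSigning s) {v u a b c : V} (hvu : s v u ≠ 0)
    (hua : s u a ≠ 0) (hab : s a b = 1) (hac : s a c = 1) (hbc : s b c = 1) (nva : v ≠ a)
    (nvb : v ≠ b) (nvc : v ≠ c) (nub : u ≠ b) (nuc : u ≠ c) (eva : s v a = 0) (evb : s v b = 0)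
    (evc : s v c = 0) (eub : s u b = 0) (euc : s u c = 0) : False := by
  have ne : ∀ {x y}, s x y = 1 → x ≠ y := fun h => hs.ne_of_sign (by rw [h]; decide)
  have h := hs.nonneg_five (hs.ne_of_sign hvu) nva nvb nvc (hs.ne_of_sign hua) nub nuc (ne hab)
    (ne hac) (ne hbc) (3 * s v u * s u a) (-5 * s u a) 5 (-2) (-2)
  have g := goldenRatio_lt
  rcases (hs.range v u).resolve_left hvu with e1 | e1 <;>
    rcases (hs.range u a).resolve_left hua with e2 | e2 <;>
    · rw [e1, e2, eva, evb, evc, eub, euc, hab, hac, hbc] at h; push_cast at h; linarith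

section Forbidden

variable (hs : GoldenSigning s) (hE : ∀ k < 15, ¬ ∃ g, IsEmbedding s (signTables.getD k []) g)
include hs hE

theorem no_negative_path {a b c : V} (hab : s a b = -1) (hac : s a c = -1) (hbc : s b c = 0)
    (nbc : b ≠ c) : False := by
  have nab : a ≠ b := hs.ne_of_sign (by rw [hab]; decide)
  have nac : a ≠ c := hs.ne_of_sign (by rw [hac]; decide)
  refine hE 0 (by decide) ⟨fun | 0 => a | 1 => b | _ => c, ?_, ?_⟩ <;>
  · intro i hi j hj
    change i < 3 at hi
    change j < 3 at hj
    interval_cases i <;> interval_cases j <;>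
      simp [signTables, entry, hs.diag, hs.symm b a, hs.symm c a, hs.symm c b, nab, nac, nbc,
        nab.symm, nac.symm, nbc.symm, hab, hac, hbc]

theorem no_square {a b c d : V} (hab : s a b = -1) (hac : s a c = 1) (hbd : s b d = 1)
    (hcd : s c d = 1) (had : s a d = 0) (hbc : s b c = 0) (nad : a ≠ d) (nbc : b ≠ c) : False := by
  have nab : a ≠ b := hs.ne_of_sign (by rw [hab]; decide)
  have nac : a ≠ c := hs.ne_of_sign (by rw [hac]; decide)
  have nbd : b ≠ d := hs.ne_of_sign (by rw [hbd]; decide)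
  have ncd : c ≠ d := hs.ne_of_sign (by rw [hcd]; decide)
  refine hE 4 (by decide) ⟨fun | 0 => a | 1 => b | 2 => c | _ => d, ?_, ?_⟩ <;>
  · intro i hi j hj
    change i < 4 at hi
    change j < 4 at hj
    interval_cases i <;> interval_cases j <;>
      simp [signTables, entry, hs.diag, hs.symm b a, hs.symm c a, hs.symm c b, hs.symm d a,
        hs.symm d b, hs.symm d c, nab, nac, nbc, nad, nbd, ncd, nab.symm, nac.symm, nbc.symm,
        nad.symm, nbd.symm, ncd.symm, hab, hac, hbc, had, hbd, hcd]

theorem no_diamond {a b c d : V} (hab : s a b = 0) (hac : s a c = 1) (had : s a d = 1)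
    (hbc : s b c = 1) (hbd : s b d = 1) (hcd : s c d = 1) (nab : a ≠ b) : False := by
  have nac : a ≠ c := hs.ne_of_sign (by rw [hac]; decide)
  have nad : a ≠ d := hs.ne_of_sign (by rw [had]; decide)
  have nbc : b ≠ c := hs.ne_of_sign (by rw [hbc]; decide)
  have nbd : b ≠ d := hs.ne_of_sign (by rw [hbd]; decide)
  have ncd : c ≠ d := hs.ne_of_sign (by rw [hcd]; decide)
  refine hE 5 (by decide) ⟨fun | 0 => a | 1 => b | 2 => c | _ => d, ?_, ?_⟩ <;>
  · intro i hi j hj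
    change i < 4 at hi
    change j < 4 at hj
    interval_cases i <;> interval_cases j <;>
      simp [signTables, entry, hs.diag, hs.symm b a, hs.symm c a, hs.symm c b, hs.symm d a,
        hs.symm d b, hs.symm d c, nab, nac, nbc, nad, nbd, ncd, nab.symm, nac.symm, nbc.symm,
        nad.symm, nbd.symm, ncd.symm, hab, hac, hbc, had, hbd, hcd]

theorem no_bowtie {a b c d e : V} (hab : s a b = 1) (hcd : s c d = 1) (hae : s a e = 1)
    (hbe : s b e = 1) (hce : s c e = 1) (hde : s d e = 1) (hac : s a c = 0) (had : s a d = 0)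
    (hbc : s b c = 0) (hbd : s b d = 0) (nac : a ≠ c) (nad : a ≠ d) (nbc : b ≠ c) (nbd : b ≠ d) :
    False := by
  have ne : ∀ {x y}, s x y = 1 → x ≠ y := fun h => hs.ne_of_sign (by rw [h]; decide)
  have nab := ne hab
  have ncd := ne hcd
  have nae := ne hae
  have nbe := ne hbe
  have nce := ne hce
  have nde := ne hde
  refine hE 10 (by decide) ⟨fun | 0 => a | 1 => b | 2 => c | 3 => d | _ => e, ?_, ?_⟩ <;>
  · intro i hi j hj
    change i < 5 at hi
    change j < 5 at hj
    interval_cases i <;> interval_cases j <;>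
      simp [signTables, entry, hs.diag, hs.symm b a, hs.symm c a, hs.symm c b, hs.symm d a,
        hs.symm d b, hs.symm d c, hs.symm e a, hs.symm e b, hs.symm e c, hs.symm e d, nab, nac,
        nbc, nad, nbd, ncd, nae, nbe, nce, nde, nab.symm, nac.symm, nbc.symm, nad.symm, nbd.symm,
        ncd.symm, nae.symm, nbe.symm, nce.symm, nde.symm, hab, hac, hbc, had, hbd, hcd, hae, hbe,
        hce, hde]

/-- A maximal positive clique with at least three vertices contains everything except pairwise
non-adjacent pendant vertices, attached to different vertices of the clique. -/
theorem exists_clique_of_triangle [Finite V] (hc : IsConnected s)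
    (htri : ∃ a b c, s a b = 1 ∧ s b c = 1 ∧ s a c = 1) :
    ∃ (R : Set V) (m : V → V), (∀ u ∈ R, ∀ v ∈ R, u ≠ v → s u v = 1) ∧
      (∀ v ∉ R, m v ∈ R ∧ s v (m v) ≠ 0) ∧ (∀ v ∉ R, ∀ a ∈ R, s v a ≠ 0 → a = m v) ∧
      (∀ v ∉ R, ∀ w ∉ R, m v = m w → v = w) ∧ ∀ v ∉ R, ∀ w ∉ R, s v w = 0 := by
  obtain ⟨a₀, b₀, c₀, hab₀, hbc₀, hac₀⟩ := htri
  have ne : ∀ {x y}, s x y = 1 → x ≠ y := fun h => hs.ne_of_sign (by rw [h]; decide)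
  obtain ⟨R, hR₀, hR⟩ := Set.Finite.exists_le_maximal
    (Set.toFinite {R : Set V | ∀ u ∈ R, ∀ v ∈ R, u ≠ v → s u v = 1})
    (a := {a₀, b₀, c₀}) (by
      rintro u (rfl | rfl | rfl) v (rfl | rfl | rfl) h <;>
        first
        | exact absurd rfl h
        | assumption
        | (rw [hs.symm]; assumption))
  have hcl : ∀ u ∈ R, ∀ v ∈ R, u ≠ v → s u v = 1 := hR.1
  have haR : a₀ ∈ R := hR₀ (by simp)
  have hbR : b₀ ∈ R := hR₀ (by simp)
  have hcR : c₀ ∈ R := hR₀ (by simp)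
  have third : ∀ x y : V, ∃ z ∈ R, z ≠ x ∧ z ≠ y := by
    intro x y
    by_contra! h
    have h1 := h a₀ haR
    have h2 := h b₀ hbR
    have h3 := h c₀ hcR
    by_cases ha : a₀ = x
    · exact ne hbc₀ ((h2 (ha ▸ (ne hab₀).symm)).trans (h3 (ha ▸ (ne hac₀).symm)).symm)
    by_cases hb : b₀ = x
    · exact ne hac₀ ((h1 ha).trans (h3 (hb ▸ (ne hbc₀).symm)).symm)
    exact ne hab₀ ((h1 ha).trans (h2 hb).symm)
  have one : ∀ v ∉ R, ∀ a ∈ R, ∀ b ∈ R, s v a ≠ 0 → s v b ≠ 0 → a = b := by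
    intro v hv a ha b hb hva hvb
    by_contra hab
    have sab := hcl a ha b hb hab
    have sba := (hs.symm b a).trans sab
    have sva := hs.triangle_pos hva hvb (by rw [sab]; decide)
    have svb := hs.triangle_pos hvb hva (by rw [sba]; decide)
    have hex : ∃ c ∈ R, s v c ≠ 1 := by
      by_contra! hall
      refine hv (hR.2 (y := insert v R) ?_ (Set.subset_insert v R) (Set.mem_insert v R))
      rintro x (rfl | hx) y (rfl | hy) hxy
      · exact absurd rfl hxy
      · exact hall y hy
      · rw [hs.symm]; exact hall x hx
      · exact hcl x hx y hy hxy
    obtain ⟨c, hcR', hvc⟩ := hex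
    have hca : c ≠ a := by rintro rfl; exact hvc sva
    have hcb : c ≠ b := by rintro rfl; exact hvc svb
    have sca := hcl c hcR' a ha hca
    have scb := hcl c hcR' b hb hcb
    have hvc0 : s v c = 0 := by
      by_contra h0
      exact hvc (hs.triangle_pos h0 hva (by rw [sca]; decide))
    exact no_diamond hs hE hvc0 sva svb sca scb sab (by rintro rfl; exact hv hcR')
  have two : ∀ v ∉ R, ∀ w ∉ R, ∀ a ∈ R, s v a ≠ 0 → s w a ≠ 0 → v = w := by
    intro v hv w hw a ha hva hwa
    by_contra hvw
    obtain ⟨b, hb, hba, -⟩ := third a a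
    obtain ⟨c, hc', hca, hcb⟩ := third a b
    have zero : ∀ x ∉ R, s x a ≠ 0 → ∀ y ∈ R, y ≠ a → s x y = 0 := by
      intro x hx hxa y hy hya
      by_contra h
      exact hya (one x hx y hy a ha h hxa)
    have nmem : ∀ {x y}, x ∉ R → y ∈ R → x ≠ y := by rintro x y hx hy rfl; exact hx hy
    have svb := zero v hv hva b hb hba
    have svc := zero v hv hva c hc' hca
    have swb := zero w hw hwa b hb hba
    have swc := zero w hw hwa c hc' hca
    by_cases hvw0 : s v w = 0
    · exact hs.no_claw (a := a) (b := v) (c := w) (d := b) (by rwa [hs.symm]) (by rwa [hs.symm])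
        (by rw [hcl a ha b hb hba.symm]; decide) hvw (nmem hv hb) (nmem hw hb) hvw0 svb swb
    · have swv : s w v ≠ 0 := by rwa [hs.symm]
      exact no_bowtie hs hE (hs.triangle_pos hvw0 hva hwa) (hcl b hb c hc' hcb.symm)
        (hs.triangle_pos hva hvw0 (by rwa [hs.symm])) (hs.triangle_pos hwa swv (by rwa [hs.symm]))
        (hcl b hb a ha hba) (hcl c hc' a ha hca) svb svc swb swc (nmem hv hb) (nmem hv hc')
        (nmem hw hb) (nmem hw hc')
  have ex : ∀ v ∉ R, ∃ a ∈ R, s v a ≠ 0 := by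
    by_contra! hcon
    obtain ⟨v₀, hv₀, hv₀'⟩ := hcon
    obtain ⟨u, hu, v, hv, hvu⟩ := hc {u | u ∈ R ∨ ∃ a ∈ R, s u a ≠ 0} ⟨a₀, Or.inl haR⟩ (fun h => by
      rcases h.symm ▸ Set.mem_univ v₀ with h | ⟨a, ha, h⟩
      · exact hv₀ h
      · exact h (hv₀' a ha))
    simp only [Set.mem_ofPred_eq, not_or, not_exists, not_and, not_not] at hv
    obtain ⟨hvR, hv0⟩ := hv
    have huR : u ∉ R := fun h => hvu (hv0 u h)
    rcases hu with hu | ⟨a, ha, hua⟩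
    · exact huR hu
    obtain ⟨b, hb, hba, -⟩ := third a a
    obtain ⟨c, hc', hca, hcb⟩ := third a b
    have zero : ∀ y ∈ R, y ≠ a → s u y = 0 := by
      intro y hy hya
      by_contra h
      exact hya (one u huR y hy a ha h hua)
    have nmem : ∀ {x y}, x ∉ R → y ∈ R → x ≠ y := by rintro x y hx hy rfl; exact hx hy
    exact hs.no_tailed_triangle hvu hua (hcl a ha b hb hba.symm) (hcl a ha c hc' hca.symm)
      (hcl b hb c hc' hcb.symm) (nmem hvR ha) (nmem hvR hb) (nmem hvR hc') (nmem huR hb)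
      (nmem huR hc') (hv0 a ha) (hv0 b hb) (hv0 c hc') (zero b hb hba) (zero c hc' hca)
  choose! m hmR hm using ex
  have uniq : ∀ v ∉ R, ∀ a ∈ R, s v a ≠ 0 → a = m v := fun v hv a ha h =>
    one v hv a ha (m v) (hmR v hv) h (hm v hv)
  have inj : ∀ v ∉ R, ∀ w ∉ R, m v = m w → v = w := fun v hv w hw h =>
    two v hv w hw (m v) (hmR v hv) (hm v hv) (h ▸ hm w hw)
  refine ⟨R, m, hcl, fun v hv => ⟨hmR v hv, hm v hv⟩, uniq, inj, fun v hv w hw => ?_⟩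
  by_contra hvw
  have nvw := hs.ne_of_sign hvw
  have nmem : ∀ {x y}, x ∉ R → y ∈ R → x ≠ y := by rintro x y hx hy rfl; exact hx hy
  have nab : m v ≠ m w := fun h => nvw (inj v hv w hw h)
  have sab := hcl _ (hmR v hv) _ (hmR w hw) nab
  have svb : s v (m w) = 0 := by
    by_contra h
    exact nab (uniq v hv _ (hmR w hw) h).symm
  have swa : s w (m v) = 0 := by
    by_contra h
    exact nab (uniq w hw _ (hmR v hv) h)
  have swv : s w v = s v w := hs.symm _ _
  have sva : s (m v) v = s v (m v) := hs.symm _ _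
  have swb : s (m w) w = s w (m w) := hs.symm _ _
  have sba : s (m w) (m v) = 1 := (hs.symm _ _).trans sab
  have saw : s (m v) w = 0 := (hs.symm _ _).trans swa
  have sbv : s (m w) v = 0 := (hs.symm _ _).trans svb
  have nvb := nmem hv (hmR w hw)
  have nwa := nmem hw (hmR v hv)
  have hprod := hs.square_neg (a := v) (b := m v) (c := m w) (d := w) (hm v hv)
    (by rw [sab]; decide) (by rw [swb]; exact hm w hw) (by rwa [swv]) nvb nwa.symm svb saw
  rw [sab, swb, swv] at hprod
  rcases (hs.range _ _).resolve_left (hm v hv) with e1 | e1 <;>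
    rcases (hs.range _ _).resolve_left (hm w hw) with e2 | e2 <;>
    rcases (hs.range _ _).resolve_left hvw with e3 | e3 <;>
    rw [e1, e2, e3] at hprod <;> norm_num at hprod
  · exact no_square hs hE e3 e1 e2 sab svb swa nvb nwa
  · exact no_square hs hE (a := w) (b := m w) (c := v) (d := m v) e2 (swv.trans e3) sba e1 swa sbv
      nwa nvb.symm
  · exact no_square hs hE (a := v) (b := m v) (c := w) (d := m w) e1 e3 sab e2 svb saw
      nvb nwa.symm
  · exact no_negative_path hs hE e1 e3 saw nwa.symm

end Forbidden

end GoldenSigning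

namespace EdgeSignedGraph

open SignTable

/-- The classification of connected golden signings. -/
theorem exists_isomorphic_Q_or_isExceptional {V : Type*} [Finite V] (S : EdgeSignedGraph V)
    (hs : GoldenSigning S.sign) (hc : IsConnected S.sign) :
    (∃ (p q r : ℕ) (h : p + q ≤ r), S.Isomorphic (Q p q r h)) ∨ S.IsExceptional := by
  have := Fintype.ofFinite V
  by_cases hE : ∃ k < 15, ∃ g, IsEmbedding S.sign (signTables.getD k []) g
  · obtain ⟨k, hk, g, hg⟩ := hE
    rcases exists_spanning_or_triangle hs hc (by omega) hg with
      ⟨k', -, hkk, g', hg', hsurj⟩ | ⟨hge, -⟩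
    · exact Or.inr (isExceptional_of_spanning S (hkk hk) hg' hsurj)
    · omega
  · push Not at hE
    have hE' : ∀ k < 15, ¬ ∃ g, IsEmbedding S.sign (signTables.getD k []) g :=
      fun k hk ⟨g, hg⟩ => hE k hk g hg
    left
    rcases isEmpty_or_nonempty V with h0 | ⟨⟨v⟩⟩
    · exact ⟨0, 0, 0, le_rfl, Isomorphic.of_sign S _
        (Sum.elim Fin.elim0 (Sum.elim Fin.elim0 Fin.elim0))
        ⟨by rintro (x | x | x) <;> exact x.elim0, fun v => h0.elim v⟩
        (by rintro (x | x | x) <;> exact x.elim0)⟩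
    have hv : IsEmbedding S.sign (signTables.getD 15 []) fun _ => v := by
      constructor <;>
      · intro i hi j hj
        change i < 1 at hi
        change j < 1 at hj
        interval_cases i; interval_cases j
        simp [signTables, entry, S.sign_self]
    rcases exists_spanning_or_triangle hs hc (by omega) hv with
      ⟨k, hk, -, g, hg, hsurj⟩ | ⟨-, htri⟩
    · refine exists_isomorphic_Q_of_spanning S ?_ hk hg hsurj
      by_contra h
      exact hE k (by omega) g hg
    · obtain ⟨R, m, h1, h2, h3, h4, h5⟩ := hs.exists_clique_of_triangle hE' hc htri
      exact exists_isomorphic_Q_of_clique S R m h1 h2 h3 h4 h5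

end EdgeSignedGraph

/-! ### The special graph of a Hoffman graph -/

theorem posSemidef_of_le_smallestEigenvalue {ι : Type*} [Fintype ι] [DecidableEq ι]
    {M : Matrix ι ι ℝ} (hM : M.IsSymm) {c : ℝ} (hc : c ≤ smallestEigenvalue M) :
    (M - c • (1 : Matrix ι ι ℝ)).PosSemidef := by
  rcases isEmpty_or_nonempty ι with h | h
  · rw [Subsingleton.elim (M - c • (1 : Matrix ι ι ℝ)) 0]
    exact Matrix.PosSemidef.zero
  have hA : (M - c • (1 : Matrix ι ι ℝ)).IsHermitian := by
    rw [Matrix.IsHermitian, Matrix.conjTranspose_eq_transpose_of_trivial, Matrix.transpose_sub,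
      Matrix.transpose_smul, Matrix.transpose_one, hM.eq]
  rw [hA.posSemidef_iff_eigenvalues_nonneg]
  intro i
  have h1 := hA.mulVec_eigenvectorBasis i
  have hne : (hA.eigenvectorBasis i : ι → ℝ) ≠ 0 := fun h0 =>
    hA.eigenvectorBasis.toBasis.ne_zero i (by ext j; simpa using congrFun h0 j)
  have h2 : M.mulVec (hA.eigenvectorBasis i) =
      (hA.eigenvalues i + c) • (hA.eigenvectorBasis i : ι → ℝ) := by
    rw [Matrix.sub_mulVec, Matrix.smul_mulVec, Matrix.one_mulVec, sub_eq_iff_eq_add] at h1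
    rw [h1, add_smul]
  have hev : Module.End.HasEigenvalue (Matrix.toLin' M) (hA.eigenvalues i + c) :=
    Module.End.hasEigenvalue_of_hasEigenvector
      ⟨Module.End.mem_eigenspace_iff.2 (by rw [Matrix.toLin'_apply]; exact h2), hne⟩
  have := (isLeast_smallestEigenvalue M hM).2 hev
  simp only [Pi.zero_apply]
  linarith

namespace HoffmanGraph

variable {V : Type*} (H : HoffmanGraph V)

/-- The number of common fat neighbours. -/
def commonFat (u v : V) : ℕ := (H.fatNeighbors u ∩ H.fatNeighbors v).ncard

theorem commonFat_comm (u v : V) : H.commonFat u v = H.commonFat v u := by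
  rw [commonFat, commonFat, Set.inter_comm]

theorem commonFat_self (u : V) : H.commonFat u u = (H.fatNeighbors u).ncard := by
  rw [commonFat, Set.inter_self]

section Finite

variable [Fintype V]

theorem commonFat_le_self (u v : V) : H.commonFat u v ≤ H.commonFat u u := by
  rw [commonFat_self]
  exact Set.ncard_le_ncard Set.inter_subset_left (Set.toFinite _)

theorem one_le_commonFat_self (hfat : H.IsFat) (v : H.Slim) : 1 ≤ H.commonFat v v := by
  rw [commonFat_self, Nat.succ_le_iff, Set.ncard_pos (Set.toFinite _)]
  exact hfat v v.2

open Classical in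
theorem B_apply (u v : H.Slim) :
    H.B u v = (if H.graph.Adj u v then 1 else 0) - (H.commonFat u v : ℝ) := by
  have h : ∑ f : H.Fat, H.fatBlock u f * H.fatBlock v f = (H.commonFat u v : ℝ) := by
    have e : ∀ f : H.Fat, H.fatBlock u f * H.fatBlock v f =
        if (f : V) ∈ H.fatNeighbors u ∩ H.fatNeighbors v then 1 else 0 := by
      intro f
      have hf := f.2
      by_cases h1 : H.graph.Adj u f <;> by_cases h2 : H.graph.Adj v f <;>
        simp [fatBlock, fatNeighbors, SimpleGraph.adjMatrix_apply, h1, h2, hf]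
    simp_rw [e]
    rw [Finset.sum_boole, commonFat, ← Set.ncard_coe_finset]
    congr 1
    rw [← Set.ncard_image_of_injective _ Subtype.val_injective]
    congr 1
    ext f
    simp only [Finset.coe_filter, Finset.mem_univ, true_and, Set.mem_image, Set.mem_ofPred_eq,
      Subtype.exists, exists_and_left, exists_prop, exists_eq_right_right]
    exact ⟨fun h => h.1, fun h => ⟨h, h.1.1⟩⟩
  rw [B, Matrix.sub_apply, Matrix.mul_apply]
  simp only [Matrix.transpose_apply]
  rw [h]
  simp [slimBlock, SimpleGraph.adjMatrix_apply]

open Classical in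
theorem nonneg_form (hmin : -1 - Real.goldenRatio ≤ H.lambdaMin) {n : ℕ} (f : Fin n → H.Slim)
    (x : Fin n → ℝ) : 0 ≤ ∑ i, ∑ j, x i * x j *
      (H.B (f i) (f j) + if f i = f j then 1 + Real.goldenRatio else 0) := by
  have h := ((posSemidef_of_le_smallestEigenvalue H.B_isSymm hmin).submatrix
    f).dotProduct_mulVec_nonneg x
  simp only [dotProduct, Matrix.mulVec, Finset.mul_sum, Matrix.submatrix_apply, Matrix.sub_apply,
    Matrix.smul_apply, Matrix.one_apply, star_trivial, smul_eq_mul] at h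
  refine h.trans_eq (Finset.sum_congr rfl fun i _ => Finset.sum_congr rfl fun j _ => ?_)
  split_ifs <;> ring

theorem commonFat_le_one (hmin : -1 - Real.goldenRatio ≤ H.lambdaMin) {u v : H.Slim} (h : u ≠ v) :
    H.commonFat u v ≤ 1 := by
  by_contra! h2
  have key := H.nonneg_form hmin ![u, v] ![1, 1]
  simp only [Fin.sum_univ_two, Matrix.cons_val_zero, Matrix.cons_val_one, B_apply, h, h.symm,
    if_true, if_false, SimpleGraph.irrefl, H.commonFat_comm v u] at key
  have h3 : (2 : ℝ) ≤ H.commonFat u v := by exact_mod_cast h2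
  have h4 : (H.commonFat u v : ℝ) ≤ H.commonFat u u := by exact_mod_cast H.commonFat_le_self u v
  have h5 : (H.commonFat u v : ℝ) ≤ H.commonFat v v := by
    rw [H.commonFat_comm]; exact_mod_cast H.commonFat_le_self v u
  have := goldenRatio_lt
  by_cases ha : H.graph.Adj u v
  · simp only [ha, ha.symm, if_true] at key
    linarith
  · simp only [ha, mt H.graph.adj_symm ha, if_false] at key
    linarith

theorem B_eq_sign (hmin : -1 - Real.goldenRatio ≤ H.lambdaMin) {u v : H.Slim} (h : u ≠ v) :
    H.B u v = (H.specialGraph.sign u v : ℝ) := by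
  have hle := H.commonFat_le_one hmin h
  rw [B_apply]
  by_cases ha : H.graph.Adj u v <;>
    by_cases hN : (H.fatNeighbors u ∩ H.fatNeighbors v).Nonempty
  · have h1 : H.commonFat u v = 1 :=
      le_antisymm hle ((Set.ncard_pos (Set.toFinite _)).2 hN)
    simp [EdgeSignedGraph.sign, specialGraph, ha, hN.ne_empty, h1]
  · have h1 := Set.not_nonempty_iff_eq_empty.1 hN
    simp [EdgeSignedGraph.sign, specialGraph, ha, h1, commonFat, h]
  · have h1 : H.commonFat u v = 1 :=
      le_antisymm hle ((Set.ncard_pos (Set.toFinite _)).2 hN)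
    simp [EdgeSignedGraph.sign, specialGraph, ha, hN, h1, h]
  · have h1 := Set.not_nonempty_iff_eq_empty.1 hN
    simp [EdgeSignedGraph.sign, specialGraph, ha, h1, commonFat]

open Classical in
/-- The form of `B + 1 + φ` in terms of the special graph. -/
theorem nonneg_sign (hmin : -1 - Real.goldenRatio ≤ H.lambdaMin) {n : ℕ} (f : Fin n → H.Slim)
    (hf : Function.Injective f) (x : Fin n → ℝ) :
    0 ≤ ∑ i, ∑ j, x i * x j * (H.specialGraph.sign (f i) (f j) : ℝ)
      + ∑ i, x i ^ 2 * (1 + Real.goldenRatio - H.commonFat (f i) (f i)) := by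
  have h := H.nonneg_form hmin f x
  have e : ∀ i j, x i * x j * (H.B (f i) (f j) + if f i = f j then 1 + Real.goldenRatio else 0) =
      x i * x j * (H.specialGraph.sign (f i) (f j) : ℝ) +
        if i = j then x i ^ 2 * (1 + Real.goldenRatio - H.commonFat (f i) (f i)) else 0 := by
    intro i j
    by_cases hij : i = j
    · subst hij
      simp only [B_apply, SimpleGraph.irrefl, if_true, if_false, EdgeSignedGraph.sign_self]
      push_cast
      ring
    · have hne : f i ≠ f j := fun h => hij (hf h)
      simp [hij, hne, H.B_eq_sign hmin hne]
  simp_rw [e, Finset.sum_add_distrib] at h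
  simpa using h

theorem isConnected_sign (hmin : -1 - Real.goldenRatio ≤ H.lambdaMin) (hind : H.Indecomposable) :
    SignTable.IsConnected H.specialGraph.sign := by
  intro X hX hX'
  by_contra! hcon
  obtain ⟨a, ha⟩ := hX
  obtain ⟨b, hb⟩ := (Set.ne_univ_iff_exists_notMem X).1 hX'
  let K : Set H.Slim → H.Subgraph := fun Y =>
    { verts := {v | (∃ h : H.IsSlim v, ⟨v, h⟩ ∈ Y) ∨ ∃ y ∈ Y, v ∈ H.fatNeighbors y}
      exists_slim_adj := by
        rintro f (⟨h, -⟩ | ⟨y, hy, hf⟩) hfat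
        · exact absurd (h.symm.trans hfat) (by simp)
        · exact ⟨y, Or.inl ⟨y.2, hy⟩, y.2, hf.2.symm⟩ }
  have hslim : ∀ (Y : Set H.Slim) (v : H.Slim), (v : V) ∈ (K Y).verts ↔ v ∈ Y := by
    intro Y v
    constructor
    · rintro (⟨h, hv⟩ | ⟨y, hy, hf⟩)
      · exact hv
      · exact absurd (v.2.symm.trans hf.1) (by simp)
    · exact fun h => Or.inl ⟨v.2, h⟩
  have hsep : ∀ i j : Fin 2, i ≠ j → ∀ x y : H.Slim, (x : V) ∈ (K (![X, Xᶜ] i)).verts →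
      (y : V) ∈ (K (![X, Xᶜ] j)).verts → x ≠ y ∧ H.specialGraph.sign x y = 0 := by
    intro i j hij x y hx hy
    rw [hslim] at hx hy
    fin_cases i <;> fin_cases j <;> simp at hij hx hy
    · exact ⟨fun h => hy (h ▸ hx), by rw [H.specialGraph.sign_comm]; exact hcon x hx y hy⟩
    · exact ⟨fun h => hx (h ▸ hy), hcon y hy x hx⟩
  refine hind ⟨2, le_rfl, fun i => K (![X, Xᶜ] i), ?_, ?_, ?_, ?_, ?_, ?_⟩
  · intro i
    fin_cases i
    · exact ⟨a, (hslim X a).2 ha⟩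
    · exact ⟨b, (hslim Xᶜ b).2 hb⟩
  · intro v
    have hcov : ∀ w : H.Slim, ∃ i, w ∈ ![X, Xᶜ] i := fun w => by
      by_cases h : w ∈ X
      · exact ⟨0, h⟩
      · exact ⟨1, h⟩
    rcases hl : H.label v with _ | _
    · obtain ⟨i, hi⟩ := hcov ⟨v, hl⟩
      exact ⟨i, (hslim _ ⟨v, hl⟩).2 hi⟩
    · obtain ⟨w, hw, hadj⟩ := H.exists_slim_adj v hl
      obtain ⟨i, hi⟩ := hcov ⟨w, hw⟩
      exact ⟨i, Or.inr ⟨⟨w, hw⟩, hi, hl, hadj.symm⟩⟩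
  · intro i j hij v hv hi hj
    exact (hsep i j hij ⟨v, hv⟩ ⟨v, hv⟩ hi hj).1 rfl
  · intro i x y hx hxi hy hadj
    exact Or.inr ⟨⟨x, hx⟩, (hslim _ ⟨x, hx⟩).1 hxi, hy, hadj⟩
  · intro i j x y hij hx hxi hy hyj
    have h := H.commonFat_le_one hmin (hsep i j hij ⟨x, hx⟩ ⟨y, hy⟩ hxi hyj).1
    rw [← (Set.toFinite _).cast_ncard_eq]
    exact_mod_cast h
  · intro i j x y hij hx hxi hy hyj
    obtain ⟨hne, hs⟩ := hsep i j hij ⟨x, hx⟩ ⟨y, hy⟩ hxi hyj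
    have h := H.B_eq_sign hmin hne
    rw [hs, B_apply] at h
    have hc : (H.fatNeighbors x ∩ H.fatNeighbors y).encard = (H.commonFat x y : ℕ) :=
      ((Set.toFinite _).cast_ncard_eq).symm
    rw [hc]
    by_cases ha : H.graph.Adj x y
    · have : (H.commonFat x y : ℝ) = 1 := by
        simp only [ha, if_true, Int.cast_zero] at h; linarith
      simp [ha, show H.commonFat x y = 1 by exact_mod_cast this]
    · have : (H.commonFat x y : ℝ) = 0 := by
        simp only [ha, if_false, Int.cast_zero] at h; linarith
      simp [ha, show H.commonFat x y = 0 by exact_mod_cast this]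

theorem goldenSigning_sign (hfat : H.IsFat) (hmin : -1 - Real.goldenRatio ≤ H.lambdaMin)
    (hone : ∀ v, H.IsSlim v → (H.fatNeighbors v).encard = 1) :
    GoldenSigning H.specialGraph.sign where
  symm := H.specialGraph.sign_comm
  diag := H.specialGraph.sign_self
  range := H.specialGraph.sign_range
  classes := by
    refine ⟨Setoid.ker fun v : H.Slim => H.fatNeighbors v, fun u v h h' => ?_, fun u v h => ?_⟩
    · rw [EdgeSignedGraph.sign_eq_one_iff] at h
      have h1 : H.fatNeighbors u = H.fatNeighbors v := h'
      have h2 := h.2.2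
      rw [h1, Set.inter_self] at h2
      exact (hfat v v.2).ne_empty h2
    · rw [EdgeSignedGraph.sign_eq_neg_one_iff] at h
      obtain ⟨f, hfu, hfv⟩ := h.2.2
      obtain ⟨a, ha⟩ := Set.encard_eq_one.1 (hone u u.2)
      obtain ⟨b, hb⟩ := Set.encard_eq_one.1 (hone v v.2)
      change H.fatNeighbors u = H.fatNeighbors v
      rw [ha] at hfu ⊢
      rw [hb] at hfv ⊢
      rw [← Set.mem_singleton_iff.1 hfu, ← Set.mem_singleton_iff.1 hfv]
  nonneg n f hf x := by
    have h := H.nonneg_sign hmin f hf x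
    have e : ∀ v : H.Slim, H.commonFat v v = 1 := fun v => by
      rw [commonFat_self, Set.ncard, hone v v.2]; rfl
    simp only [e, Nat.cast_one, add_sub_cancel_left] at h
    rwa [← Finset.sum_mul, mul_comm (∑ i, x i ^ 2)] at h

/-- A slim vertex with two fat neighbours leaves room for at most one further slim vertex. -/
theorem isomorphic_of_two_fatNeighbors (hfat : H.IsFat) (hind : H.Indecomposable)
    (hmin : -1 - Real.goldenRatio ≤ H.lambdaMin) (v : H.Slim)
    (hv : 2 ≤ (H.fatNeighbors (v : V)).encard) :
    H.specialGraph.Isomorphic (EdgeSignedGraph.Q 0 0 1 (by decide)) ∨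
      H.specialGraph.Isomorphic (EdgeSignedGraph.Q 1 0 1 (by decide)) ∨
      H.specialGraph.Isomorphic (EdgeSignedGraph.Q 0 1 1 (by decide)) := by
  have hcon := H.isConnected_sign hmin hind
  have g1 := goldenRatio_gt
  have g2 := goldenRatio_lt
  have hsq := Real.goldenRatio_sq
  set s := H.specialGraph.sign with hs
  have hself : ∀ w, s w w = 0 := H.specialGraph.sign_self
  have hcomm : ∀ w w', s w w' = s w' w := H.specialGraph.sign_comm
  have hrange : ∀ w w', s w w' = 0 ∨ s w w' = 1 ∨ s w w' = -1 := H.specialGraph.sign_range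
  have hv2 : (2 : ℝ) ≤ H.commonFat v v := by
    rw [← (Set.toFinite _).cast_ncard_eq, ← commonFat_self] at hv
    exact_mod_cast hv
  have h1 : ∀ w : H.Slim, (1 : ℝ) ≤ H.commonFat w w := fun w => by
    exact_mod_cast H.one_le_commonFat_self hfat w
  by_cases huniv : ({v} : Set H.Slim) = Set.univ
  · have hall : ∀ w, w = v := fun w => by
      have : w ∈ ({v} : Set H.Slim) := huniv.symm ▸ Set.mem_univ w
      exact this
    refine Or.inl (EdgeSignedGraph.Isomorphic.of_sign _ _
      (Sum.elim Fin.elim0 (Sum.elim Fin.elim0 fun _ => v)) ⟨?_, fun w => ?_⟩ ?_)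
    · rintro (i | i | i) (j | j | j) - <;> first | exact i.elim0 | exact j.elim0 | skip
      rw [Subsingleton.elim i j]
    · exact ⟨.inr (.inr 0), (hall w).symm⟩
    · rintro (i | i | i) (j | j | j) <;> first | exact i.elim0 | exact j.elim0 | skip
      have : H.specialGraph.sign v v = 0 := hself v
      simp [EdgeSignedGraph.Q, this, Subsingleton.elim i j]
  obtain ⟨v', hv', u, hu, huv⟩ := hcon {v} ⟨v, rfl⟩ huniv
  obtain rfl : v' = v := hv'
  have hne : u ≠ v' := hu
  have hone : ∀ w : H.Slim, s w v' ≠ 0 → w ≠ v' → (H.commonFat w w : ℝ) = 1 := by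
    intro w hw hwv
    refine le_antisymm ?_ (h1 w)
    by_contra! hlt
    have h2 : (2 : ℝ) ≤ H.commonFat w w := by
      have : 1 < H.commonFat w w := by exact_mod_cast hlt
      exact_mod_cast this
    have key := H.nonneg_sign hmin ![v', w] (by
      intro i j; fin_cases i <;> fin_cases j <;> simp [hwv, hwv.symm]) ![1, -s w v']
    simp only [Fin.sum_univ_two, Matrix.cons_val_zero, Matrix.cons_val_one, ← hs, hself,
      hcomm v' w] at key
    rcases (hrange w v').resolve_left hw with e | e <;> rw [e] at key <;> push_cast at key <;>
      linarith
  have hu1 := hone u huv hne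
  have hall : ∀ w, w = v' ∨ w = u := by
    by_contra! hw
    obtain ⟨w₀, hw1, hw2⟩ := hw
    obtain ⟨x, hx, w, hw, hwx⟩ := hcon {v', u} ⟨v', by simp⟩ (fun h => by
      have : w₀ ∈ ({v', u} : Set H.Slim) := h.symm ▸ Set.mem_univ w₀
      simp [hw1, hw2] at this)
    simp only [Set.mem_insert_iff, Set.mem_singleton_iff, not_or] at hw hx
    have hw1 := h1 w
    set a : ℝ := ((s w v' : ℤ) : ℝ) with ha
    set b : ℝ := ((s w u : ℤ) : ℝ) with hb
    set ε : ℝ := ((s u v' : ℤ) : ℝ) with hε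
    have hε2 : ε = 1 ∨ ε = -1 := by
      rcases (hrange u v').resolve_left huv with e | e <;> simp [hε, e]
    have ha' : a = 0 ∨ a = 1 ∨ a = -1 := by
      rcases hrange w v' with e | e | e <;> simp [ha, e]
    have hb' : b = 0 ∨ b = 1 ∨ b = -1 := by
      rcases hrange w u with e | e | e <;> simp [hb, e]
    have hab : ¬ (a = 0 ∧ b = 0) := by
      rintro ⟨e1, e2⟩
      rcases hx with rfl | rfl
      · exact hwx (by rw [ha] at e1; exact_mod_cast e1)
      · exact hwx (by rw [hb] at e2; exact_mod_cast e2)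
    have key : ∀ y : ℝ, 0 ≤ 2 * y * (Real.goldenRatio * a - ε * b) + y ^ 2 * Real.goldenRatio := by
      intro y
      have h := H.nonneg_sign hmin ![v', u, w] (by
        intro i j
        fin_cases i <;> fin_cases j <;>
          simp [hne, hne.symm, hw.1, hw.2, Ne.symm hw.1, Ne.symm hw.2])
        ![Real.goldenRatio, -ε, y]
      simp only [Fin.sum_univ_three, Matrix.cons_val, ← hs, hself, hcomm v' u, hcomm v' w,
        hcomm u w, ← ha, ← hb, ← hε, hu1] at h
      have e1 : Real.goldenRatio ^ 3 = 2 * Real.goldenRatio + 1 := by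
        rw [pow_succ, hsq]; linear_combination hsq
      have e2 : y ^ 2 * (1 + Real.goldenRatio - H.commonFat w w) ≤ y ^ 2 * Real.goldenRatio :=
        mul_le_mul_of_nonneg_left (by linarith) (sq_nonneg y)
      have e3 : Real.goldenRatio ^ 2 * (1 + Real.goldenRatio - H.commonFat v' v') ≤
          Real.goldenRatio ^ 2 * (Real.goldenRatio - 1) :=
        mul_le_mul_of_nonneg_left (by linarith) (sq_nonneg _)
      have e4 : ε ^ 2 = 1 := by rcases hε2 with e | e <;> rw [e] <;> norm_num
      push_cast at h
      nlinarith
    have hzero : Real.goldenRatio * a - ε * b = 0 := by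
      set c := Real.goldenRatio * a - ε * b
      have := key (-c / 2)
      nlinarith [sq_nonneg c]
    rcases hε2 with e | e <;> rcases ha' with e1 | e1 | e1 <;> rcases hb' with e2 | e2 | e2 <;>
      first
      | exact hab ⟨e1, e2⟩
      | (rw [e, e1, e2] at hzero; linarith)
  right
  rcases (hrange u v').resolve_left huv with e | e
  · left
    refine EdgeSignedGraph.Isomorphic.of_sign _ _
      (Sum.elim (fun _ => u) (Sum.elim Fin.elim0 fun _ => v')) ⟨?_, fun w => ?_⟩ ?_
    · rintro (i | i | i) (j | j | j) h <;> first | exact i.elim0 | exact j.elim0 | skip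
      · rw [Subsingleton.elim i j]
      · exact absurd h hne
      · exact absurd h.symm hne
      · rw [Subsingleton.elim i j]
    · rcases hall w with rfl | rfl
      · exact ⟨.inr (.inr 0), rfl⟩
      · exact ⟨.inl 0, rfl⟩
    · have e' : s v' u = 1 := (hcomm _ _).trans e
      rintro (i | i | i) (j | j | j) <;> first | exact i.elim0 | exact j.elim0 | skip
      all_goals simp [EdgeSignedGraph.Q, ← hs, e, e', hself]
      all_goals omega
  · right
    refine EdgeSignedGraph.Isomorphic.of_sign _ _
      (Sum.elim Fin.elim0 (Sum.elim (fun _ => u) fun _ => v')) ⟨?_, fun w => ?_⟩ ?_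
    · rintro (i | i | i) (j | j | j) h <;> first | exact i.elim0 | exact j.elim0 | skip
      · rw [Subsingleton.elim i j]
      · exact absurd h hne
      · exact absurd h.symm hne
      · rw [Subsingleton.elim i j]
    · rcases hall w with rfl | rfl
      · exact ⟨.inr (.inr 0), rfl⟩
      · exact ⟨.inr (.inl 0), rfl⟩
    · have e' : s v' u = -1 := (hcomm _ _).trans e
      rintro (i | i | i) (j | j | j) <;> first | exact i.elim0 | exact j.elim0 | skip
      all_goals simp [EdgeSignedGraph.Q, ← hs, e, e', hself]
      all_goals omega

end Finite

end HoffmanGraph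

end

theorem mainTheorem4 {V : Type*} [Fintype V] (H : HoffmanGraph V)
    (hfat : H.IsFat) (hind : H.Indecomposable)
    (hmin : -1 - Real.goldenRatio ≤ H.lambdaMin) :
    ((∃ v, H.IsSlim v ∧ 2 ≤ (H.fatNeighbors v).encard) →
      H.specialGraph.Isomorphic (EdgeSignedGraph.Q 0 0 1 (by decide)) ∨
      H.specialGraph.Isomorphic (EdgeSignedGraph.Q 1 0 1 (by decide)) ∨
      H.specialGraph.Isomorphic (EdgeSignedGraph.Q 0 1 1 (by decide))) ∧
    ((∀ v, H.IsSlim v → (H.fatNeighbors v).encard = 1) →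
      (∃ (p q r : ℕ) (h : p + q ≤ r), H.specialGraph.Isomorphic (EdgeSignedGraph.Q p q r h)) ∨
      H.specialGraph.IsExceptional) :=
  ⟨fun ⟨v, hv, h2⟩ => H.isomorphic_of_two_fatNeighbors hfat hind hmin ⟨v, hv⟩ h2,
    fun hone => H.specialGraph.exists_isomorphic_Q_or_isExceptional
      (H.goldenSigning_sign hfat hmin hone) (H.isConnected_sign hmin hind)⟩
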